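/- **Refined super-polynomial error decay with near-constant coreset size.** *Setting.* For $\mathbf Q\in\mathbb R^{m\times d}$ with rows $\mathbf q_i$, $\mathbf K\in\mathbb R^{n\times d}$ with rows $\mathbf k_l$, $\mathbf V\in\mathbb R^{n\times d}$ and $\beta>0$, let $\mathbf O\in\mathbb R^{m\times d}$, $\mathbf O_{ij}=\sum_l e^{\beta\langle \mathbf q_i,\mathbf k_l\rangle}\mathbf V_{lj}\big/\sum_l e^{\beta\langle \mathbf q_i,\mathbf k_l\rangle}$, be the softmax attention matrix. Let $\|\cdot\|_{\max}$ be the largest absolute entry of a matrix, $\bar{\mathbf k}=\frac1n\sum_l\mathbf k_l$, $\mathbf k_l'=\mathbf k_l-\bar{\mathbf k}$, $R_Q=\max_i\|\mathbf q_i\|_2$ and $R_K=\max_l\|\mathbf k_l'\|_2$. Write $W_0$ for the principal branch of the Lambert function, $\rho_0=\sqrt{1+e^{W_0(2/e^2)+2}}$, $b_0=\frac{\log n}{\beta R_QR_K}+2$ and $\tau=\sqrt{\frac{R_K}{R_Q}\cdot\frac{b_0}{2W_0(b_0/(2\rho_0))}}$. *Algorithm* (WildCat with one bin and rank parameter $r$).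 Put $h_\tau(x,y)=e^{\beta\langle x,y\rangle/\tau^2}$. Starting from $\mathcal S=\emptyset$ and $p_l=h_\tau(\mathbf k_l',\mathbf k_l')$, perform $r$ rounds of randomly pivoted Nyström: draw $s$ with probability $p_s/\sum_l p_l$, add $s$ to $\mathcal S$, and update $p$ to the diagonal of the residual $h_\tau(\mathbf K',\mathbf K')-h_\tau(\mathbf K',\mathbf K'_{\mathcal S})h_\tau(\mathbf K'_{\mathcal S},\mathbf K'_{\mathcal S})^{-1}h_\tau(\mathbf K'_{\mathcal S},\mathbf K')$ (the inverse is maintained by rank-one updates; stop if $p=0$). With $\mathbf W=h_\tau(\mathbf K'_{\mathcal S},\mathbf K'_{\mathcal S})^{-1}h_\tau(\mathbf K'_{\mathcal S},\mathbf K')$, $\mathbf w=\mathbf W\mathbf 1$ and $\widehat{\mathbf A}=(e^{\beta\langle\mathbf q_i,\mathbf k_l\rangle})_{i\in[m],\,l\in\mathcal S}$, the output $\widehat{\mathbf O}_r$ has entries $(\widehat{\mathbf A}\mathbf W\mathbf V)_{ij}/(\widehat{\mathbf A}\mathbf w)_i$ if $(\widehat{\mathbf A}\mathbf w)_i>0$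 and $0$ otherwise, each clipped to $[\min_l\mathbf V_{lj},\max_l\mathbf V_{lj}]$. *Statement.* Let $d(n)\ge1$ be integers and let $\gamma(n)>0$ and $a(n)\ge\frac12$ be reals, for $n\ge2$; put $\delta(n)=d(n)/\log n$. Write $f\in n^{o(g)}$ if, for all large $n$, $f(n)=n^{e(n)}$ with $e\in o(g)$. Suppose that, as $n\to\infty$, either 1. $\gamma\in o(1)$ and $a\in o\!\left(\frac{\log(1/\gamma(n))}{\max\{\log\delta(n),1\}}\right)\cap n^{o(1)}$, or 2. $\delta\in o(1)$, $\gamma\in\Omega(1)\cap n^{o(1/d)}$ and $a\in n^{o(1/d)}$. Then there is a sequence of coreset sizes $r(n)\in n^{o(1)}$ such that for every $n\ge2$, every $m$, every $\beta>0$ and all $\mathbf Q\in\mathbb R^{m\times d(n)}$, $\mathbf K,\mathbf V\in\mathbb R^{n\times d(n)}$ with $\frac{\beta R_QR_K}{\log n}=\gamma(n)$, $$\mathbb E\,\|\mathbf O-\widehat{\mathbf O}_{r(n)}\|_{\max}\le 3\,\|\mathbf V\|_{\max}\,n^{-a(n)}.$$ -/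

import Mathlib

open Filter Asymptotics
open scoped ENNReal Topology

namespace WildCat

/-- The principal branch `W₀` of the Lambert function: for `z ≥ -1/e`, the unique `w ≥ -1` with
`w * exp w = z`. -/
noncomputable def lambertW (z : ℝ) : ℝ :=
  Function.invFunOn (fun w : ℝ => w * Real.exp w) (Set.Ici (-1)) z

/-- `ρ₀ = √(1 + exp (W₀ (2 / e²) + 2)) ≈ 3.19`. -/
noncomputable def rhoZero : ℝ :=
  Real.sqrt (1 + Real.exp (lambertW (2 / Real.exp 2) + 2))

/-- `‖A‖_max`, the largest absolute value of an entry. -/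
noncomputable def maxNorm {m d : ℕ} (A : Matrix (Fin m) (Fin d) ℝ) : ℝ :=
  ⨆ ij : Fin m × Fin d, |A ij.1 ij.2|

/-- `‖A‖_{2,∞}`, the largest Euclidean norm of a row. -/
noncomputable def rowNorm {m d : ℕ} (A : Matrix (Fin m) (Fin d) ℝ) : ℝ :=
  ⨆ i : Fin m, Real.sqrt (∑ j, A i j ^ 2)

/-- The mean `k̄` of the rows of `K`. -/
noncomputable def rowMean {n d : ℕ} (K : Matrix (Fin n) (Fin d) ℝ) : Fin d → ℝ :=
  fun j => (∑ l, K l j) / n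

/-- The recentred matrix, with rows `k_l - k̄`. -/
noncomputable def recenter {n d : ℕ} (K : Matrix (Fin n) (Fin d) ℝ) : Matrix (Fin n) (Fin d) ℝ :=
  Matrix.of fun l j => K l j - rowMean K j

/-- The exponential kernel `h(x, y) = exp (β ⟨x, y⟩)`. -/
noncomputable def expKernel {d : ℕ} (β : ℝ) (x y : Fin d → ℝ) : ℝ :=
  Real.exp (β * (x ⬝ᵥ y))

/-- The exact softmax matrix `O = D⁻¹ A V`. -/
noncomputable def softmaxAttention {m n d : ℕ} (β : ℝ) (Q : Matrix (Fin m) (Fin d) ℝ)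
    (K V : Matrix (Fin n) (Fin d) ℝ) : Matrix (Fin m) (Fin d) ℝ :=
  Matrix.of fun i j =>
    (∑ l, expKernel β (Q i) (K l) * V l j) / ∑ l, expKernel β (Q i) (K l)

/-! ### Randomly pivoted Nyström (RPNys) -/

/-- The variables of RPNys: the coreset rows `KS` selected so far, the inverse `M` of the coreset
kernel matrix, the kernel rows `R = h(KS, K)`, and the residual kernel diagonal `p`. The first
three are stored in arrays with `r` slots; slots that are not yet filled hold zeros. -/
structure RPNysState (n d r : ℕ) where
  KS : Matrix (Fin r) (Fin d) ℝ
  M : Matrix (Fin r) (Fin r) ℝ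
  R : Matrix (Fin r) (Fin n) ℝ
  p : Fin n → ℝ

/-- Initialisation of RPNys. -/
noncomputable def rpnysInit {n d : ℕ} (h : (Fin d → ℝ) → (Fin d → ℝ) → ℝ)
    (K : Matrix (Fin n) (Fin d) ℝ) (r : ℕ) : RPNysState n d r where
  KS := 0
  M := 0
  R := 0
  p := fun l => h (K l) (K l)

/-- The update of all variables in round `i` when index `s` has been drawn as pivot. -/
noncomputable def rpnysUpdate {n d r : ℕ} (h : (Fin d → ℝ) → (Fin d → ℝ) → ℝ)
    (K : Matrix (Fin n) (Fin d) ℝ) (i : Fin r) (st : RPNysState n d r) (s : Fin n) :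
    RPNysState n d r :=
  let g : Fin r → ℝ := fun j =>
    Function.update (st.M.mulVec fun t => st.R t s) i (-1) j / Real.sqrt (st.p s)
  let M' := st.M + Matrix.vecMulVec g g
  let R' := st.R.updateRow i fun l => h (K s) (K l)
  let δ : Fin n → ℝ := Matrix.vecMul g R'
  { KS := st.KS.updateRow i (K s)
    M := M'
    R := R'
    p := Function.update (fun l => st.p l - δ l ^ 2) s 0 }

/-- Round `i` of RPNys: draw the pivot `s` with probability `p s / ∑ l, p l` and update. (The
residual diagonal `p` is nonnegative.) If the residual diagonal vanishes, so that the kernel matrix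
is already reproduced exactly, nothing further is selected. -/
noncomputable def rpnysRound {n d r : ℕ} (h : (Fin d → ℝ) → (Fin d → ℝ) → ℝ)
    (K : Matrix (Fin n) (Fin d) ℝ) (i : Fin r) (st : RPNysState n d r) :
    PMF (RPNysState n d r) :=
  open Classical in
  if h0 : ∑' l, ENNReal.ofReal (st.p l) = 0 then PMF.pure st
  else
    (PMF.normalize (fun l => ENNReal.ofReal (st.p l)) h0
      (by rw [tsum_fintype]; exact ENNReal.sum_ne_top.mpr fun _ _ => ENNReal.ofReal_ne_top)).map
      (rpnysUpdate h K i st)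

/-- The law of the variables of RPNys with rank parameter `r` after its first `t` rounds. -/
noncomputable def rpnysRounds {n d : ℕ} (h : (Fin d → ℝ) → (Fin d → ℝ) → ℝ)
    (K : Matrix (Fin n) (Fin d) ℝ) (r : ℕ) : (t : ℕ) → t ≤ r → PMF (RPNysState n d r)
  | 0, _ => PMF.pure (rpnysInit h K r)
  | t + 1, ht =>
    (rpnysRounds h K r t (Nat.le_of_succ_le ht)).bind fun st => rpnysRound h K ⟨t, ht⟩ st

/-- RPNys: the law of the coreset `KS` and of the Nyström weights `W = M R`. (A slot of the coreset
that stays empty has weight zero.) -/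
noncomputable def rpnys {n d : ℕ} (h : (Fin d → ℝ) → (Fin d → ℝ) → ℝ)
    (K : Matrix (Fin n) (Fin d) ℝ) (r : ℕ) :
    PMF (Matrix (Fin r) (Fin d) ℝ × Matrix (Fin r) (Fin n) ℝ) :=
  (rpnysRounds h K r r le_rfl).map fun st => (st.KS, st.M * st.R)

/-! ### The WildCat algorithm with one bin -/

/-- The temperature `τ`. -/
noncomputable def temperature (β RQ RK : ℝ) (n : ℕ) : ℝ :=
  let b₀ := Real.log n / (β * RQ * RK) + 2
  Real.sqrt (RK / RQ * (b₀ / (2 * lambertW (b₀ / (2 * rhoZero)))))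

/-- CompressKV with one bin: the law of the compressed keys `KS`, of the compressed values
`VS = W V` and of the weights `w = W 1`. -/
noncomputable def compressKV {n d : ℕ} (K V : Matrix (Fin n) (Fin d) ℝ) (RQ β : ℝ) (r : ℕ) :
    PMF (Matrix (Fin r) (Fin d) ℝ × Matrix (Fin r) (Fin d) ℝ × (Fin r → ℝ)) :=
  let K' := recenter K
  let τ := temperature β RQ (rowNorm K') n
  (rpnys (expKernel (β / τ ^ 2)) K' r).map fun o =>
    (Matrix.of fun i j => o.1 i j + rowMean K j, o.2 * V, fun i => ∑ l, o.2 i l)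

/-- WtdAttn: attention with the compressed keys and values, clipped to `[vmin, vmax]`. -/
noncomputable def wtdAttn {m d r : ℕ} (Q : Matrix (Fin m) (Fin d) ℝ)
    (KS VS : Matrix (Fin r) (Fin d) ℝ) (w : Fin r → ℝ) (vmin vmax : Fin d → ℝ) (β : ℝ) :
    Matrix (Fin m) (Fin d) ℝ :=
  open Classical in
  Matrix.of fun i j =>
    let den := ∑ l, expKernel β (Q i) (KS l) * w l
    let num := ∑ l, expKernel β (Q i) (KS l) * VS l j
    max (vmin j) (min (if 0 < den then num / den else 0) (vmax j))

/-- WildCat with one bin and rank parameter `r`: the law of its output. -/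
noncomputable def wildcat {m n d : ℕ} (Q : Matrix (Fin m) (Fin d) ℝ)
    (K V : Matrix (Fin n) (Fin d) ℝ) (β : ℝ) (r : ℕ) : PMF (Matrix (Fin m) (Fin d) ℝ) :=
  (compressKV K V (rowNorm Q) β r).map fun c =>
    wtdAttn Q c.1 c.2.1 c.2.2 (fun j => ⨅ l, V l j) (fun j => ⨆ l, V l j) β

/-- The expectation of a `[0, ∞]`-valued function of a random element with law `P`. -/
noncomputable def expectation {α : Type*} (P : PMF α) (f : α → ℝ≥0∞) : ℝ≥0∞ :=
  ∑' x, P x * f x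

/-- `f ∈ n^{o(g)}`: eventually `f n = n ^ e n` for some exponent `e ∈ o(g)`. -/
def InPowLittleO (f g : ℕ → ℝ) : Prop :=
  ∃ e : ℕ → ℝ, e =o[atTop] g ∧ ∀ᶠ n in atTop, f n = (n : ℝ) ^ e n

end WildCat

namespace WildCat

/-! With `θ = τ²` one has `exp (β⟨q, k⟩) = h_τ(θq, k)`, so the weights computed by RPNys replace
each attention entry by itself minus the Nyström residual at `(θq, k)`. Every pivot replaces the
residual by a Schur complement; hence the residual stays a positive semidefinite kernel on all of
`ℝᵈ`, dominated by `h_τ`, not only on the keys. Cauchy–Schwarz bounds the squared entry error by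
`exp (βθ‖q‖²) p_l`, where `p` is the residual diagonal. Recentring the keys makes every softmax
denominator at least `n`, and a clipped average is stable under such perturbations, so only the
expected trace of the residual has to be controlled (`maxNorm_sub_wtdAttn_le`).

If the trace is `T` and the residual matrix is `R`, one round lowers the expected trace by `‖R‖_F² /
T`. Truncating the exponential series at degree `s` puts the kernel matrix within an entrywise `η`
of one whose columns lie in a space of dimension at most `q = (d+s choose s)`. Projecting onto that
space gives `T (T - 2n²η) ≤ q ‖R‖_F²` (`trace_mul_le_of_le`). The trace therefore contracts by `1 -
1/q` per round down to a floor `2n²η` (`expectation_rounds_le`), and `r ≥ qZ` rounds suffice, where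
`Z` is the logarithm of the required accuracy.

All exponents are multiples of `log n` expressed through `γ`, and the temperature enters only via
elementary bounds on `tempScale γ`. The series is truncated with ratio `ρ = 1/γ` when `γ → 0`, and
with `ρ = e` when `γ` is bounded below. In both regimes `log q` and `log Z` are `o(log n)`. The
remaining finitely many `n` may use any sufficient rank. -/

/-- Symmetric positive semidefinite kernels. -/
structure IsPSDKernel {X : Type} (k : X → X → ℝ) : Prop where
  symm : ∀ x y, k x y = k y x
  nonneg : ∀ (ι : Type) [Fintype ι] (x : ι → X) (v : ι → ℝ),
    0 ≤ ∑ i, ∑ j, v i * v j * k (x i) (x j)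

/-! ### Cauchy–Schwarz and Schur complements for positive semidefinite kernels -/

namespace IsPSDKernel

variable {X : Type} {k : X → X → ℝ}

theorem diag_nonneg (hk : IsPSDKernel k) (x : X) : 0 ≤ k x x := by
  simpa using hk.nonneg Unit (fun _ => x) (fun _ => 1)

theorem sq_le (hk : IsPSDKernel k) (x y : X) : k x y ^ 2 ≤ k x x * k y y := by
  have key : ∀ a b : ℝ, 0 ≤ a * a * k x x + 2 * a * b * k x y + b * b * k y y := by
    intro a b
    have := hk.nonneg (Fin 2) ![x, y] ![a, b]
    simp only [Fin.sum_univ_two, Matrix.cons_val_zero, Matrix.cons_val_one] at this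
    rw [hk.symm y x] at this
    linarith
  have h0 := hk.diag_nonneg y
  rcases h0.eq_or_lt with h | h
  · by_contra hne
    have hxy : k x y ≠ 0 := by
      rintro h2
      exact hne (by rw [h2, ← h]; simp)
    -- The form is affine in the second weight when `k y y = 0`; this weight makes it equal to `-1`.
    have h1 := key 1 (-(k x x + 1) / (2 * k x y))
    have h2 : 2 * 1 * (-(k x x + 1) / (2 * k x y)) * k x y = -(k x x + 1) := by field_simp
    rw [h2, ← h] at h1
    linarith
  · have h1 := key (k y y) (-k x y)
    have h2 : 0 ≤ k y y * (k x x * k y y - k x y ^ 2) := by nlinarith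
    have := nonneg_of_mul_nonneg_right h2 h
    linarith

theorem eq_zero_of_diag (hk : IsPSDKernel k) {x : X} (hx : k x x = 0) (y : X) : k x y = 0 := by
  have := hk.sq_le x y
  rw [hx, zero_mul] at this
  exact pow_eq_zero_iff (two_ne_zero) |>.1 (le_antisymm this (sq_nonneg _))

theorem sum_schur (s : X) (ι : Type) [Fintype ι] (x : ι → X) (v : ι → ℝ) :
    ∑ i, ∑ j, v i * v j * (k (x i) (x j) - k s (x i) * k s (x j) / k s s) =
      (∑ i, ∑ j, v i * v j * k (x i) (x j)) - (∑ i, v i * k s (x i)) ^ 2 / k s s := by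
  have : (∑ i, v i * k s (x i)) ^ 2 / k s s =
      ∑ i, ∑ j, v i * v j * (k s (x i) * k s (x j) / k s s) := by
    rw [sq, Finset.sum_mul_sum, Finset.sum_div]
    refine Finset.sum_congr rfl fun i _ => ?_
    rw [Finset.sum_div]
    exact Finset.sum_congr rfl fun j _ => by ring
  rw [this, ← Finset.sum_sub_distrib]
  refine Finset.sum_congr rfl fun i _ => ?_
  rw [← Finset.sum_sub_distrib]
  exact Finset.sum_congr rfl fun j _ => by ring

/-- Adjoin `s` to the points with the weight `-b / k s s` that minimises the enlarged quadratic
form; the minimum is the form of the Schur complement. -/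
theorem schur (hk : IsPSDKernel k) {s : X} (hs : 0 < k s s) :
    IsPSDKernel fun x y => k x y - k s x * k s y / k s s where
  symm x y := by rw [hk.symm x y]; ring
  nonneg ι _ x v := by
    rw [sum_schur]
    set b := ∑ i, v i * k s (x i) with hb
    have h := hk.nonneg (Option ι) (fun o => o.elim s x) (fun o => o.elim (-b / k s s) v)
    simp only [Fintype.sum_option, Option.elim, Finset.sum_add_distrib] at h
    have h1 : ∑ j, -b / k s s * v j * k s (x j) = -b / k s s * b := by
      rw [hb, Finset.mul_sum]; exact Finset.sum_congr rfl fun j _ => by ring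
    have h2 : ∑ i, v i * (-b / k s s) * k (x i) s = -b / k s s * b := by
      rw [hb, Finset.mul_sum]
      exact Finset.sum_congr rfl fun j _ => by rw [hk.symm (x j) s]; ring
    rw [h1, h2] at h
    have h3 : -b / k s s * (-b / k s s) * k s s = b ^ 2 / k s s := by field_simp
    have h4 : -b / k s s * b = - (b ^ 2 / k s s) := by ring
    rw [h3, h4] at h
    linarith

end IsPSDKernel

/-! ### The exponential kernel is positive semidefinite -/

section Exp

variable {d : ℕ}

theorem expKernel_comm (c : ℝ) (x y : Fin d → ℝ) : expKernel c x y = expKernel c y x := by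
  rw [expKernel, expKernel, dotProduct_comm]

theorem dotProduct_pow_eq (x y : Fin d → ℝ) (j : ℕ) :
    (x ⬝ᵥ y) ^ j = ∑ α : Fin j → Fin d, (∏ i, x (α i)) * ∏ i, y (α i) := by
  rw [dotProduct, Fintype.sum_pow]
  exact Finset.sum_congr rfl fun α _ => Finset.prod_mul_distrib

/-- The power of the inner product is the inner product of the vectors of ordered degree-`j`
monomials, so the form is a sum of squares. -/
theorem sum_dotProduct_pow_nonneg {ι : Type} [Fintype ι] (x : ι → Fin d → ℝ) (v : ι → ℝ)
    (j : ℕ) : 0 ≤ ∑ a, ∑ b, v a * v b * (x a ⬝ᵥ x b) ^ j := by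
  have : ∑ a, ∑ b, v a * v b * (x a ⬝ᵥ x b) ^ j =
      ∑ α : Fin j → Fin d, (∑ a, v a * ∏ i, x a (α i)) ^ 2 := by
    simp_rw [dotProduct_pow_eq, sq, Finset.sum_mul_sum, Finset.mul_sum]
    rw [Finset.sum_comm' (t' := Finset.univ) (s' := fun _ => Finset.univ) (by simp)]
    rw [Finset.sum_comm]
    simp_rw [Finset.sum_comm (t := (Finset.univ : Finset (Fin j → Fin d)))]
    refine Finset.sum_congr rfl fun α _ => Finset.sum_congr rfl fun a _ =>
      Finset.sum_congr rfl fun b _ => by ring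
  rw [this]
  exact Finset.sum_nonneg fun _ _ => sq_nonneg _

theorem isPSDKernel_expKernel {c : ℝ} (hc : 0 ≤ c) : IsPSDKernel (expKernel (d := d) c) where
  symm := expKernel_comm c
  nonneg ι _ x v := by
    have h : HasSum (fun j : ℕ => ∑ a, ∑ b, v a * v b * ((c * (x a ⬝ᵥ x b)) ^ j / j.factorial))
        (∑ a, ∑ b, v a * v b * expKernel c (x a) (x b)) := by
      refine hasSum_sum fun a _ => hasSum_sum fun b _ => HasSum.mul_left _ ?_
      rw [expKernel, Real.exp_eq_exp_ℝ]
      exact NormedSpace.expSeries_div_hasSum_exp _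
    refine h.nonneg fun j => ?_
    have h2 : ∑ a, ∑ b, v a * v b * ((c * (x a ⬝ᵥ x b)) ^ j / j.factorial) =
        c ^ j / j.factorial * ∑ a, ∑ b, v a * v b * (x a ⬝ᵥ x b) ^ j := by
      simp_rw [Finset.mul_sum]
      exact Finset.sum_congr rfl fun a _ => Finset.sum_congr rfl fun b _ => by
        rw [mul_pow]; ring
    rw [h2]
    exact mul_nonneg (by positivity) (sum_dotProduct_pow_nonneg x v j)

end Exp

/-! ### The invariant of RPNys: each pivot takes a Schur complement -/

section Invariant

variable {n d r : ℕ} {h : (Fin d → ℝ) → (Fin d → ℝ) → ℝ} {K : Matrix (Fin n) (Fin d) ℝ}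

/-- The residual of the Nyström approximation of `h` carried by a state. -/
noncomputable def residual (h : (Fin d → ℝ) → (Fin d → ℝ) → ℝ) (st : RPNysState n d r)
    (x y : Fin d → ℝ) : ℝ :=
  h x y - ∑ i, ∑ j, h x (st.KS i) * st.M i j * h (st.KS j) y

/-- What holds of the variables of RPNys after `t` rounds. -/
structure IsValid (h : (Fin d → ℝ) → (Fin d → ℝ) → ℝ) (K : Matrix (Fin n) (Fin d) ℝ) (t : ℕ)
    (st : RPNysState n d r) : Prop where
  slot : ∀ j : Fin r, (∀ k, st.M j k = 0 ∧ st.M k j = 0) ∨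
    ((j : ℕ) < t ∧ ∀ l, st.R j l = h (st.KS j) (K l))
  diag : ∀ l, st.p l = residual h st (K l) (K l)
  psd : IsPSDKernel (residual h st)
  le : ∀ (ι : Type) [Fintype ι] (x : ι → Fin d → ℝ) (v : ι → ℝ),
    ∑ i, ∑ j, v i * v j * residual h st (x i) (x j) ≤ ∑ i, ∑ j, v i * v j * h (x i) (x j)

theorem isValid_init (hh : IsPSDKernel h) : IsValid h K 0 (rpnysInit h K r) := by
  have h0 : residual h (rpnysInit h K r) = h := by
    funext x y; simp [residual, rpnysInit]
  exact ⟨fun j => Or.inl fun k => by simp [rpnysInit], fun l => by rw [h0]; rfl,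
    by rwa [h0], fun ι _ x v => by rw [h0]⟩

theorem IsValid.mono {t t' : ℕ} {st : RPNysState n d r} (hst : IsValid h K t st) (ht : t ≤ t') :
    IsValid h K t' st :=
  { hst with slot := fun j => (hst.slot j).imp_right fun hj => ⟨hj.1.trans_le ht, hj.2⟩ }

theorem IsValid.p_nonneg {t : ℕ} {st : RPNysState n d r} (hst : IsValid h K t st) (l : Fin n) :
    0 ≤ st.p l := by
  rw [hst.diag]; exact hst.psd.diag_nonneg _

/-- The vector `g` of an RPNys update. -/
noncomputable def updateVec (i : Fin r) (st : RPNysState n d r) (s : Fin n) : Fin r → ℝ := fun j =>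
  Function.update (st.M.mulVec fun t => st.R t s) i (-1) j / Real.sqrt (st.p s)

/-- The strict bound on filled slots in `IsValid` keeps slot `i` unused before round `i`, so the
update may overwrite it without disturbing the earlier approximation. -/
theorem IsValid.row_eq_zero {i : Fin r} {st : RPNysState n d r} (hst : IsValid h K i st) (k : Fin r) :
    st.M i k = 0 ∧ st.M k i = 0 := by
  rcases hst.slot i with h1 | h1
  · exact h1 k
  · exact absurd h1.1 (lt_irrefl _)

/-- The entry `-1` of `g` contributes the kernel at the new pivot and the other entries its current
approximation. Thus the rank-one term `g gᵀ` subtracts exactly the normalised residual column of the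
pivot. -/
theorem IsValid.sum_updateVec {i : Fin r} {st : RPNysState n d r} (hst : IsValid h K i st)
    (s : Fin n) (x : Fin d → ℝ) :
    ∑ j, h x ((st.KS.updateRow i (K s)) j) * updateVec i st s j =
      - residual h st x (K s) / Real.sqrt (st.p s) := by
  have h1 : ∀ j, h x ((st.KS.updateRow i (K s)) j) * updateVec i st s j =
      ((∑ k, h x (st.KS j) * st.M j k * h (st.KS k) (K s)) -
        if j = i then h x (K s) else 0) / Real.sqrt (st.p s) := by
    intro j
    rw [updateVec]
    by_cases hj : j = i
    · subst hj
      have : ∑ k, h x (st.KS j) * st.M j k * h (st.KS k) (K s) = 0 :=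
        Finset.sum_eq_zero fun k _ => by rw [(hst.row_eq_zero k).1]; ring
      rw [this]
      simp only [Matrix.updateRow_self, Function.update_self, if_true]
      ring
    · rw [Matrix.updateRow_ne hj, Function.update_of_ne hj, if_neg hj, sub_zero, mul_div_assoc',
        Matrix.mulVec, dotProduct, Finset.mul_sum]
      congr 1
      refine Finset.sum_congr rfl fun k _ => ?_
      rcases hst.slot k with h2 | h2
      · rw [(h2 j).2]; ring
      · rw [h2.2 s]; ring
  simp_rw [h1]
  rw [← Finset.sum_div, Finset.sum_sub_distrib, Finset.sum_ite_eq' Finset.univ i]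
  simp only [Finset.mem_univ, if_true, residual]
  ring

theorem IsValid.residual_update (hh : IsPSDKernel h) {i : Fin r} {st : RPNysState n d r}
    (hst : IsValid h K i st) {s : Fin n} (hs : 0 < st.p s) (x y : Fin d → ℝ) :
    residual h (rpnysUpdate h K i st s) x y = residual h st x y -
      residual h st (K s) x * residual h st (K s) y / residual h st (K s) (K s) := by
  have e1 : ∑ a, ∑ b, h x ((st.KS.updateRow i (K s)) a) *
        (st.M + Matrix.vecMulVec (updateVec i st s) (updateVec i st s)) a b *
        h ((st.KS.updateRow i (K s)) b) y =
      (∑ a, ∑ b, h x (st.KS a) * st.M a b * h (st.KS b) y) +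
        (∑ a, h x ((st.KS.updateRow i (K s)) a) * updateVec i st s a) *
        (∑ b, h y ((st.KS.updateRow i (K s)) b) * updateVec i st s b) := by
    rw [Finset.sum_mul_sum, ← Finset.sum_add_distrib]
    refine Finset.sum_congr rfl fun a _ => ?_
    rw [← Finset.sum_add_distrib]
    refine Finset.sum_congr rfl fun b _ => ?_
    rw [Matrix.add_apply, Matrix.vecMulVec_apply, hh.symm y]
    have : h x ((st.KS.updateRow i (K s)) a) * st.M a b * h ((st.KS.updateRow i (K s)) b) y =
        h x (st.KS a) * st.M a b * h (st.KS b) y := by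
      by_cases ha : a = i
      · subst ha; rw [(hst.row_eq_zero b).1]; ring
      by_cases hb : b = i
      · subst hb; rw [(hst.row_eq_zero a).2]; ring
      rw [Matrix.updateRow_ne ha, Matrix.updateRow_ne hb]
    rw [← this]; ring
  have e2 : residual h (rpnysUpdate h K i st s) x y = h x y -
      ∑ a, ∑ b, h x ((st.KS.updateRow i (K s)) a) *
        (st.M + Matrix.vecMulVec (updateVec i st s) (updateVec i st s)) a b *
        h ((st.KS.updateRow i (K s)) b) y := rfl
  rw [e2, e1, hst.sum_updateVec, hst.sum_updateVec, ← hst.diag s, hst.psd.symm (K s) x,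
    hst.psd.symm (K s) y]
  have : - residual h st x (K s) / √(st.p s) * (- residual h st y (K s) / √(st.p s)) =
      residual h st x (K s) * residual h st y (K s) / st.p s := by
    rw [div_mul_div_comm, Real.mul_self_sqrt hs.le, neg_mul_neg]
  rw [this, sub_add_eq_sub_sub]; rfl

theorem IsValid.update (hh : IsPSDKernel h) {i : Fin r} {st : RPNysState n d r}
    (hst : IsValid h K i st) {s : Fin n} (hs : 0 < st.p s) :
    IsValid h K (i + 1) (rpnysUpdate h K i st s) := by
  have hres := hst.residual_update hh hs
  have hs' : 0 < residual h st (K s) (K s) := by rwa [← hst.diag]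
  have hslot : ∀ j : Fin r, (∀ k, (rpnysUpdate h K i st s).M j k = 0 ∧
      (rpnysUpdate h K i st s).M k j = 0 ∧ updateVec i st s j = 0) ∨
    ((j : ℕ) < i + 1 ∧ ∀ l, (rpnysUpdate h K i st s).R j l =
      h ((rpnysUpdate h K i st s).KS j) (K l)) := by
    intro j
    have eR : (rpnysUpdate h K i st s).R = st.R.updateRow i fun l => h (K s) (K l) := rfl
    have eK : (rpnysUpdate h K i st s).KS = st.KS.updateRow i (K s) := rfl
    have eM : (rpnysUpdate h K i st s).M =
      st.M + Matrix.vecMulVec (updateVec i st s) (updateVec i st s) := rfl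
    by_cases hj : j = i
    · subst hj
      right
      refine ⟨Nat.lt_succ_self _, fun l => ?_⟩
      rw [eR, eK, Matrix.updateRow_self, Matrix.updateRow_self]
    · rcases hst.slot j with h1 | h1
      · left
        have : updateVec i st s j = 0 := by
          rw [updateVec, Function.update_of_ne hj, Matrix.mulVec, dotProduct,
            Finset.sum_eq_zero (fun k _ => by rw [(h1 k).1, zero_mul]), zero_div]
        intro k
        simp [eM, Matrix.vecMulVec_apply, this, h1 k]
      · right
        refine ⟨h1.1.trans (Nat.lt_succ_self _), fun l => ?_⟩
        rw [eR, eK, Matrix.updateRow_ne hj, Matrix.updateRow_ne hj, h1.2]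
  refine ⟨fun j => (hslot j).imp_left fun h1 k => ⟨(h1 k).1, (h1 k).2.1⟩, fun l => ?_, ?_, ?_⟩
  · rw [hres]
    have hp : (rpnysUpdate h K i st s).p = Function.update (fun l => st.p l -
      (∑ j, updateVec i st s j * (rpnysUpdate h K i st s).R j l) ^ 2) s 0 := rfl
    by_cases hl : l = s
    · subst hl
      rw [hp, Function.update_self]
      -- At the pivot the Schur complement is `p - p²/p = 0`, the value that the algorithm writes
      -- explicitly.
      field_simp
      ring
    · rw [hp, Function.update_of_ne hl]
      have : ∑ j, updateVec i st s j * (rpnysUpdate h K i st s).R j l =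
          ∑ j, h (K l) ((st.KS.updateRow i (K s)) j) * updateVec i st s j := by
        refine Finset.sum_congr rfl fun j _ => ?_
        rcases hslot j with h1 | h1
        · rw [(h1 j).2.2]; ring
        · rw [h1.2, hh.symm, mul_comm]; rfl
      rw [this, hst.sum_updateVec, hst.diag, div_pow, Real.sq_sqrt hs.le, hst.diag s,
        hst.psd.symm (K s) (K l)]
      ring
  · have := hst.psd.schur hs'
    convert this using 1
    funext x y
    exact hres x y
  · intro ι _ x v
    simp_rw [hres]
    rw [IsPSDKernel.sum_schur]
    have := hst.le ι x v
    have h3 : 0 ≤ (∑ i, v i * residual h st (K s) (x i)) ^ 2 / residual h st (K s) (K s) := by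
      positivity
    linarith

end Invariant

/-! ### Polynomial approximation and trace versus Frobenius norm -/

section LowRank

/-- The matrix of the orthogonal projection onto a subspace of `ℝⁿ`. -/
theorem exists_projection {n : ℕ} (U : Submodule ℝ (EuclideanSpace ℝ (Fin n))) :
    ∃ P : Matrix (Fin n) (Fin n) ℝ, P.transpose = P ∧ P * P = P ∧
      P.trace = Module.finrank ℝ U ∧ ∀ v ∈ U, P.mulVec (v : Fin n → ℝ) = v := by
  let b := stdOrthonormalBasis ℝ U
  let C : Matrix (Fin n) (Fin (Module.finrank ℝ U)) ℝ :=
    Matrix.of fun i k => (b k : EuclideanSpace ℝ (Fin n)) i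
  have hC : C.transpose * C = 1 := by
    ext k l
    have h1 := orthonormal_iff_ite.1 b.orthonormal l k
    rw [Matrix.mul_apply, Matrix.one_apply]
    simp only [Submodule.coe_inner, PiLp.inner_apply, RCLike.inner_apply, conj_trivial] at h1
    simp only [Matrix.transpose_apply, C, Matrix.of_apply]
    rw [h1]
    exact if_congr eq_comm rfl rfl
  refine ⟨C * C.transpose, ?_, ?_, ?_, fun v hv => ?_⟩
  · rw [Matrix.transpose_mul, Matrix.transpose_transpose]
  · rw [Matrix.mul_assoc, ← Matrix.mul_assoc C.transpose, hC, Matrix.one_mul]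
  · rw [Matrix.trace_mul_comm, hC, Matrix.trace_one, Fintype.card_fin]
  · have hw : (v : Fin n → ℝ) = C.mulVec fun k => b.repr ⟨v, hv⟩ k := by
      have h1 := congrArg (fun u : U => (u : EuclideanSpace ℝ (Fin n))) (b.sum_repr ⟨v, hv⟩)
      funext i
      have h2 := congrArg (fun u : EuclideanSpace ℝ (Fin n) => u i) h1
      simp only [Submodule.coe_sum, Submodule.coe_smul, WithLp.ofLp_sum, WithLp.ofLp_smul,
        Finset.sum_apply, Pi.smul_apply, smul_eq_mul] at h2
      rw [← h2, Matrix.mulVec, dotProduct]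
      exact Finset.sum_congr rfl fun k _ => mul_comm _ _
    rw [hw, Matrix.mulVec_mulVec, Matrix.mul_assoc, hC, Matrix.mul_one]

/-- A matrix dominated by an almost low-rank matrix has a large Frobenius norm relative to its
trace. -/
theorem trace_mul_le_of_le {n : ℕ} {R H G P : Matrix (Fin n) (Fin n) ℝ} {q η : ℝ}
    (hPt : P.transpose = P) (hPP : P * P = P) (hPG : P * G = G) (hq : P.trace ≤ q)
    (hη : ∀ i j, |H i j - G i j| ≤ η)
    (hdom : ∀ v : Fin n → ℝ, ∑ i, ∑ j, v i * v j * R i j ≤ ∑ i, ∑ j, v i * v j * H i j)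
    (hR : 0 ≤ R.trace) :
    R.trace * (R.trace - 2 * (n ^ 2 * η)) ≤ q * ∑ i, ∑ j, R i j ^ 2 := by
  set B : Matrix (Fin n) (Fin n) ℝ := 1 - P with hB
  have hBt : B.transpose = B := by rw [hB, Matrix.transpose_sub, hPt, Matrix.transpose_one]
  have hBB : B * B = B := by
    rw [hB, Matrix.sub_mul, Matrix.mul_sub, Matrix.mul_sub, hPP]; simp
  have hBs : ∀ i j, B i j = B j i := fun i j => by
    conv_lhs => rw [← hBt]
    rfl
  -- As `B = B²` is symmetric, `tr (B X)` sums the quadratic form of `X` over the rows of `B`; this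
  -- is how domination of forms passes to traces.
  have hquad : ∀ X : Matrix (Fin n) (Fin n) ℝ,
      (B * X).trace = ∑ a, ∑ i, ∑ j, B a i * B a j * X i j := by
    intro X
    conv_lhs => rw [← hBB, Matrix.mul_assoc, Matrix.trace_mul_comm, Matrix.trace]
    refine Finset.sum_congr rfl fun a _ => ?_
    rw [Matrix.diag_apply, Matrix.mul_apply, Finset.sum_comm]
    refine Finset.sum_congr rfl fun j _ => ?_
    rw [Matrix.mul_apply, Finset.sum_mul]
    refine Finset.sum_congr rfl fun i _ => ?_
    rw [hBs j a]; ring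
  have hBle : ∀ i j, |B i j| ≤ 1 := by
    intro i j
    have h1 : B i i = ∑ k, B i k ^ 2 := by
      conv_lhs => rw [← hBB, Matrix.mul_apply]
      exact Finset.sum_congr rfl fun k _ => by rw [hBs k i, sq]
    have h2 : ∀ k, B i k ^ 2 ≤ B i i := fun k => by
      rw [h1]
      exact Finset.single_le_sum (f := fun k => B i k ^ 2) (fun _ _ => sq_nonneg _)
        (Finset.mem_univ k)
    have h3 : B i i ≤ 1 := by nlinarith [h2 i]
    exact abs_le_one_iff_mul_self_le_one.2 (by nlinarith [h2 j])
  have h1 : R.trace = (P * R).trace + (B * R).trace := by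
    rw [← Matrix.trace_add, ← Matrix.add_mul, hB]; simp
  have h2 : (B * R).trace ≤ (B * H).trace := by
    rw [hquad, hquad]
    exact Finset.sum_le_sum fun a _ => hdom fun i => B a i
  have hBG : B * G = 0 := by rw [hB, Matrix.sub_mul, hPG]; simp
  have h3 : (B * H).trace ≤ n ^ 2 * η := by
    have : B * H = B * (H - G) := by rw [Matrix.mul_sub, hBG, sub_zero]
    rw [this, Matrix.trace]
    calc ∑ i, (B * (H - G)).diag i ≤ ∑ i : Fin n, ∑ j : Fin n, η := by
          refine Finset.sum_le_sum fun i _ => ?_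
          rw [Matrix.diag_apply, Matrix.mul_apply]
          refine Finset.sum_le_sum fun j _ => ?_
          refine (le_abs_self _).trans ?_
          rw [abs_mul, Matrix.sub_apply]
          have := hη j i
          calc |B i j| * |H j i - G j i| ≤ 1 * η :=
                mul_le_mul (hBle i j) this (abs_nonneg _) zero_le_one
            _ = η := one_mul _
      _ = n ^ 2 * η := by simp; ring
  have hS : 0 ≤ ∑ i, ∑ j, R i j ^ 2 :=
    Finset.sum_nonneg fun _ _ => Finset.sum_nonneg fun _ _ => sq_nonneg _
  have hPtr : P.trace = ∑ i, ∑ j, P i j ^ 2 := by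
    conv_lhs => rw [← hPP, Matrix.trace]
    refine Finset.sum_congr rfl fun i _ => ?_
    rw [Matrix.diag_apply, Matrix.mul_apply]
    refine Finset.sum_congr rfl fun j _ => ?_
    have : P j i = P i j := by
      conv_lhs => rw [← hPt]
      rfl
    rw [this, sq]
  -- Cauchy–Schwarz for the Frobenius inner product, with `‖P‖_F² = tr P ≤ q`.
  have h4 : (P * R).trace ^ 2 ≤ q * ∑ i, ∑ j, R i j ^ 2 := by
    refine le_trans ?_ (mul_le_mul_of_nonneg_right hq hS)
    rw [hPtr]
    have hRt : ∑ i, ∑ j, R i j ^ 2 = ∑ i, ∑ j, R j i ^ 2 := Finset.sum_comm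
    rw [hRt]
    have e : (P * R).trace = ∑ ij : Fin n × Fin n, P ij.1 ij.2 * R ij.2 ij.1 := by
      rw [Fintype.sum_prod_type]; rfl
    rw [e]
    have := Finset.sum_mul_sq_le_sq_mul_sq (Finset.univ : Finset (Fin n × Fin n))
      (fun ij => P ij.1 ij.2) (fun ij => R ij.2 ij.1)
    rwa [Fintype.sum_prod_type (f := fun ij : Fin n × Fin n => P ij.1 ij.2 ^ 2),
      Fintype.sum_prod_type (f := fun ij : Fin n × Fin n => R ij.2 ij.1 ^ 2)] at this
  have hη0 : 0 ≤ (n : ℝ) ^ 2 * η := by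
    rcases Nat.eq_zero_or_pos n with h0 | h0
    · subst h0; simp
    · exact mul_nonneg (by positivity) ((abs_nonneg _).trans (hη ⟨0, h0⟩ ⟨0, h0⟩))
  have hq0 : 0 ≤ q * ∑ i, ∑ j, R i j ^ 2 := (sq_nonneg _).trans h4
  -- With `ε = n²η`, either the left side is nonpositive, or `T (T - 2ε) ≤ (T - ε)² ≤ (tr PR)²`.
  rcases le_or_gt R.trace (2 * (n ^ 2 * η)) with h5 | h5
  · nlinarith
  · nlinarith

/-- Tail bound for the exponential series. -/
theorem abs_exp_sub_sum_le {z x ρ : ℝ} (hz : |z| ≤ x) (hρ : 1 ≤ ρ) (N : ℕ) :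
    |Real.exp z - ∑ j ∈ Finset.range N, z ^ j / j.factorial| ≤ Real.exp (ρ * x) / ρ ^ N := by
  have hx : 0 ≤ x := (abs_nonneg z).trans hz
  have hs : ∀ y : ℝ, HasSum (fun j : ℕ => y ^ j / j.factorial) (Real.exp y) := fun y => by
    rw [Real.exp_eq_exp_ℝ]; exact NormedSpace.expSeries_div_hasSum_exp y
  have h1 := (hasSum_nat_add_iff' N).2 (hs z)
  have h2 := ((hasSum_nat_add_iff' N).2 (hs (ρ * x))).div_const (ρ ^ N)
  rw [← h1.tsum_eq, ← Real.norm_eq_abs]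
  refine (tsum_of_norm_bounded h2 fun j => ?_).trans ?_
  -- The tail at `z` is compared termwise with the tail at `ρx`: a term of degree `j + N` gains
  -- `ρ^(j+N) ≥ ρ^N`.
  · rw [Real.norm_eq_abs, abs_div, abs_pow, Nat.abs_cast, div_right_comm]
    refine div_le_div_of_nonneg_right ?_ (by positivity)
    rw [le_div_iff₀ (by positivity), mul_pow, mul_comm]
    gcongr
    linarith
  · refine div_le_div_of_nonneg_right ?_ (by positivity)
    have : 0 ≤ ∑ j ∈ Finset.range N, (ρ * x) ^ j / j.factorial :=
      Finset.sum_nonneg fun _ _ => by positivity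
    linarith

/-- The exponential kernel matrix is close to one whose columns lie in the space of polynomials of
degree at most `s`. -/
theorem exists_projection_expKernel {n d : ℕ} (K : Matrix (Fin n) (Fin d) ℝ) {c x ρ : ℝ}
    (hx : ∀ i j, |c * (K i ⬝ᵥ K j)| ≤ x) (hρ : 1 ≤ ρ) (s : ℕ) :
    ∃ P G : Matrix (Fin n) (Fin n) ℝ, P.transpose = P ∧ P * P = P ∧ P * G = G ∧
      P.trace ≤ ((d + s).choose s : ℕ) ∧
      ∀ i j, |expKernel c (K i) (K j) - G i j| ≤ Real.exp (ρ * x) / ρ ^ (s + 1) := by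
  classical
  -- Homogenisation: `none` is an extra variable evaluated at `1`, so size-`s` multisets index all
  -- monomials of degree at most `s`.
  let f : Sym (Option (Fin d)) s → EuclideanSpace ℝ (Fin n) := fun z =>
    WithLp.toLp 2 fun l => (z.1.map fun o => o.elim 1 (K l)).prod
  let U := Submodule.span ℝ (Set.range f)
  obtain ⟨P, h1, h2, h3, h4⟩ := exists_projection U
  let G : Matrix (Fin n) (Fin n) ℝ := Matrix.of fun i j =>
    ∑ k ∈ Finset.range (s + 1), (c * (K i ⬝ᵥ K j)) ^ k / k.factorial
  refine ⟨P, G, h1, h2, ?_, ?_, fun i j => ?_⟩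
  · have hmono : ∀ k ≤ s, ∀ α : Fin k → Fin d,
        (WithLp.toLp 2 fun l => ∏ i, K l (α i) : EuclideanSpace ℝ (Fin n)) ∈ U := by
      intro k hk α
      refine Submodule.subset_span ⟨⟨Finset.univ.val.map (fun i => some (α i)) +
        Multiset.replicate (s - k) none, ?_⟩, ?_⟩
      · simp; omega
      · simp only [f]
        congr 1
        funext l
        simp [Finset.prod]
        rfl
    have hcol : ∀ j, (WithLp.toLp 2 fun i => G i j : EuclideanSpace ℝ (Fin n)) ∈ U := by
      intro j
      have : (WithLp.toLp 2 fun i => G i j : EuclideanSpace ℝ (Fin n)) =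
          ∑ k ∈ Finset.range (s + 1), ∑ α : Fin k → Fin d,
            (c ^ k / k.factorial * ∏ i, K j (α i)) •
              (WithLp.toLp 2 fun l => ∏ i, K l (α i) : EuclideanSpace ℝ (Fin n)) := by
        ext i
        simp only [G, Matrix.of_apply, WithLp.ofLp_sum, WithLp.ofLp_smul, Finset.sum_apply,
          Pi.smul_apply, smul_eq_mul]
        refine Finset.sum_congr rfl fun k _ => ?_
        rw [mul_pow, dotProduct_pow_eq, mul_div_right_comm, Finset.mul_sum]
        exact Finset.sum_congr rfl fun α _ => by ring
      rw [this]
      refine Submodule.sum_mem _ fun k hk => Submodule.sum_mem _ fun α _ =>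
        Submodule.smul_mem _ _ (hmono k ?_ α)
      have := Finset.mem_range.1 hk
      omega
    ext i j
    have := congrFun (h4 _ (hcol j)) i
    simpa [Matrix.mul_apply, Matrix.mulVec, dotProduct] using this
  · rw [h3]
    have : Module.finrank ℝ U ≤ Fintype.card (Sym (Option (Fin d)) s) := finrank_range_le_card f
    rw [Sym.card_sym_eq_choose] at this
    simp only [Fintype.card_option, Fintype.card_fin] at this
    rw [show d + 1 + s - 1 = d + s by omega] at this
    exact_mod_cast this
  · exact abs_exp_sub_sum_le (hx i j) hρ (s + 1)

end LowRank

/-! ### Expectations under a `PMF` -/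

section Expectation

variable {α β : Type*}

theorem expectation_pure (a : α) (f : α → ℝ≥0∞) : expectation (PMF.pure a) f = f a := by
  rw [expectation, tsum_eq_single a]
  · simp
  · intro b hb
    simp [PMF.pure_apply_of_ne _ _ hb]

theorem expectation_bind (P : PMF α) (F : α → PMF β) (f : β → ℝ≥0∞) :
    expectation (P.bind F) f = expectation P fun a => expectation (F a) f := by
  simp only [expectation, PMF.bind_apply, ← ENNReal.tsum_mul_right, ← ENNReal.tsum_mul_left]
  rw [ENNReal.tsum_comm]
  exact tsum_congr fun a => tsum_congr fun b => mul_assoc _ _ _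

theorem expectation_map (P : PMF α) (g : α → β) (f : β → ℝ≥0∞) :
    expectation (P.map g) f = expectation P (f ∘ g) := by
  rw [← PMF.bind_pure_comp, expectation_bind]
  simp only [Function.comp_def, expectation_pure]

theorem expectation_mono {P : PMF α} {f g : α → ℝ≥0∞} (h : ∀ a ∈ P.support, f a ≤ g a) :
    expectation P f ≤ expectation P g := by
  refine ENNReal.tsum_le_tsum fun a => ?_
  by_cases ha : a ∈ P.support
  · gcongr
    exact h a ha
  · rw [PMF.mem_support_iff, not_not] at ha
    simp [ha]

theorem expectation_mul_add (P : PMF α) (f : α → ℝ≥0∞) (a b : ℝ≥0∞) :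
    expectation P (fun x => a * f x + b) = a * expectation P f + b := by
  simp only [expectation, mul_add]
  rw [ENNReal.tsum_add, ENNReal.tsum_mul_right, PMF.tsum_coe, one_mul, ← ENNReal.tsum_mul_left]
  congr 1
  exact tsum_congr fun x => by ring

end Expectation

/-! ### Contraction of the expected residual trace -/

section Rounds

variable {n d r : ℕ} {h : (Fin d → ℝ) → (Fin d → ℝ) → ℝ} {K : Matrix (Fin n) (Fin d) ℝ}

theorem isValid_of_mem_support_round (hh : IsPSDKernel h) {i : Fin r} {st : RPNysState n d r}
    (hst : IsValid h K i st) {st' : RPNysState n d r} (h' : st' ∈ (rpnysRound h K i st).support) :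
    IsValid h K (i + 1) st' := by
  rw [rpnysRound] at h'
  split_ifs at h' with h0
  · rw [PMF.mem_support_pure_iff] at h'
    subst h'
    exact hst.mono (Nat.le_succ _)
  · obtain ⟨s, hs, rfl⟩ := (PMF.mem_support_map_iff _ _ _).1 h'
    rw [PMF.mem_support_normalize_iff] at hs
    exact hst.update hh (ENNReal.ofReal_pos.1 (pos_iff_ne_zero.2 hs))

theorem isValid_of_mem_support (hh : IsPSDKernel h) (t : ℕ) (ht : t ≤ r) {st : RPNysState n d r}
    (hs : st ∈ (rpnysRounds h K r t ht).support) : IsValid h K t st := by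
  induction t generalizing st with
  | zero =>
    rw [rpnysRounds, PMF.mem_support_pure_iff] at hs
    subst hs
    exact isValid_init hh
  | succ t ih =>
    rw [rpnysRounds, PMF.mem_support_bind_iff] at hs
    obtain ⟨st', h1, h2⟩ := hs
    exact isValid_of_mem_support_round hh (i := ⟨t, ht⟩) (ih _ h1) h2

/-- One round of RPNys contracts the expected trace of the residual. -/
theorem expectation_round_le (hh : IsPSDKernel h) {i : Fin r} {st : RPNysState n d r}
    (hst : IsValid h K i st) {q ε : ℝ} (hq : 1 ≤ q) (hε : 0 ≤ ε)
    (hF : (∑ l, st.p l) * ((∑ l, st.p l) - 2 * ε) ≤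
      q * ∑ l, ∑ k, residual h st (K l) (K k) ^ 2) :
    expectation (rpnysRound h K i st) (fun st' => ENNReal.ofReal (∑ l, st'.p l)) ≤
      ENNReal.ofReal ((1 - 1 / q) * (∑ l, st.p l) + 2 * ε / q) := by
  have hq0 : 0 < q := by linarith
  have hp := hst.p_nonneg
  set T := ∑ l, st.p l with hT
  have hT0 : 0 ≤ T := Finset.sum_nonneg fun l _ => hp l
  have hsum : ∑' l, ENNReal.ofReal (st.p l) = ENNReal.ofReal T := by
    rw [tsum_fintype, ENNReal.ofReal_sum_of_nonneg fun l _ => hp l]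
  rw [rpnysRound]
  split_ifs with h0
  · rw [expectation_pure]
    rw [hsum, ENNReal.ofReal_eq_zero] at h0
    have : T = 0 := le_antisymm h0 hT0
    refine ENNReal.ofReal_le_ofReal ?_
    rw [← hT, this]
    have : 0 ≤ 2 * ε / q := by positivity
    linarith
  · have hTpos : 0 < T := by
      rw [hsum] at h0
      exact ENNReal.ofReal_pos.1 (pos_iff_ne_zero.2 h0)
    rw [expectation_map, expectation, tsum_fintype]
    set S : Fin n → ℝ := fun l => ∑ k, residual h st (K l) (K k) ^ 2 with hS
    -- The probability `p l / T` cancels the division by `p l` in the Schur complement. An index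
    -- with `p l = 0` also has `S l = 0`, because its whole residual row vanishes.
    have hterm : ∀ l, 0 ≤ st.p l * T - S l ∧
        PMF.normalize (fun l => ENNReal.ofReal (st.p l)) h0
          (by rw [tsum_fintype]; exact ENNReal.sum_ne_top.mpr fun _ _ => ENNReal.ofReal_ne_top) l *
          ((fun st' : RPNysState n d r => ENNReal.ofReal (∑ l, st'.p l)) ∘ rpnysUpdate h K i st) l
          ≤ ENNReal.ofReal ((st.p l * T - S l) / T) := by
      intro l
      rw [PMF.normalize_apply, hsum]
      rcases (hp l).eq_or_lt with h1 | h1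
      · have : S l = 0 := Finset.sum_eq_zero fun k _ => by
          rw [hst.psd.eq_zero_of_diag (by rw [← hst.diag, ← h1])]; simp
        rw [← h1, this]; simp
      · have h2 := hst.update hh h1
        have h3 : ∑ k, (rpnysUpdate h K i st l).p k = T - S l / st.p l := by
          rw [hT, hS, Finset.sum_div, ← Finset.sum_sub_distrib]
          refine Finset.sum_congr rfl fun k _ => ?_
          rw [h2.diag, hst.residual_update hh h1, ← hst.diag, ← hst.diag]
          ring
        have h4 : 0 ≤ T - S l / st.p l := by
          rw [← h3]; exact Finset.sum_nonneg fun k _ => h2.p_nonneg k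
        have h5 : st.p l * T - S l = st.p l * (T - S l / st.p l) := by field_simp
        refine ⟨by rw [h5]; positivity, ?_⟩
        rw [Function.comp_apply, h3, ← ENNReal.ofReal_inv_of_pos hTpos,
          ← ENNReal.ofReal_mul h1.le, ← ENNReal.ofReal_mul (by positivity), h5]
        refine le_of_eq ?_
        congr 1
        ring
    refine (Finset.sum_le_sum fun l _ => (hterm l).2).trans ?_
    rw [← ENNReal.ofReal_sum_of_nonneg fun l _ => div_nonneg (hterm l).1 hT0]
    refine ENNReal.ofReal_le_ofReal ?_
    rw [← Finset.sum_div, Finset.sum_sub_distrib, ← Finset.sum_mul, ← hT, div_le_iff₀ hTpos]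
    have h6 : T * (T - 2 * ε) / q ≤ ∑ l, S l := by
      rw [div_le_iff₀ hq0, mul_comm (∑ l, S l)]
      exact hF
    have h7 : ((1 - 1 / q) * T + 2 * ε / q) * T = T * T - T * (T - 2 * ε) / q := by
      field_simp; ring
    rw [h7]
    linarith

/-- Expected trace of the residual after `t` rounds. -/
theorem expectation_rounds_le (hh : IsPSDKernel h) {q η : ℝ} (hq : 1 ≤ q) (hη : 0 ≤ η)
    {P G : Matrix (Fin n) (Fin n) ℝ}
    (hPt : P.transpose = P) (hPP : P * P = P) (hPG : P * G = G) (hPq : P.trace ≤ q)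
    (hG : ∀ i j, |h (K i) (K j) - G i j| ≤ η) (t : ℕ) (ht : t ≤ r) :
    expectation (rpnysRounds h K r t ht) (fun st => ENNReal.ofReal (∑ l, st.p l)) ≤
      ENNReal.ofReal ((1 - 1 / q) ^ t * (∑ l, h (K l) (K l)) + 2 * (n ^ 2 * η)) := by
  have hθ : 0 ≤ 1 - 1 / q := by
    have : 1 / q ≤ 1 := by rw [div_le_one (by linarith)]; exact hq
    linarith
  have hT0 : 0 ≤ ∑ l, h (K l) (K l) := Finset.sum_nonneg fun l _ => hh.diag_nonneg _
  induction t with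
  | zero =>
    rw [rpnysRounds, expectation_pure]
    refine ENNReal.ofReal_le_ofReal ?_
    rw [pow_zero, one_mul]
    have : 0 ≤ 2 * (n ^ 2 * η) := by positivity
    simp only [rpnysInit]
    linarith
  | succ t ih =>
    rw [rpnysRounds, expectation_bind]
    have h1 : ∀ st ∈ (rpnysRounds h K r t (Nat.le_of_succ_le ht)).support,
        expectation (rpnysRound h K ⟨t, ht⟩ st) (fun st' => ENNReal.ofReal (∑ l, st'.p l)) ≤
          ENNReal.ofReal (1 - 1 / q) * ENNReal.ofReal (∑ l, st.p l) +
            ENNReal.ofReal (2 * (n ^ 2 * η) / q) := by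
      intro st hs
      have hst : IsValid h K ((⟨t, ht⟩ : Fin r) : ℕ) st := isValid_of_mem_support hh t _ hs
      have hTr : (Matrix.of fun l k => residual h st (K l) (K k)).trace = ∑ l, st.p l :=
        Finset.sum_congr rfl fun l _ => (hst.diag l).symm
      have hp : 0 ≤ ∑ l, st.p l := Finset.sum_nonneg fun l _ => hst.p_nonneg l
      refine (expectation_round_le hh hst hq (ε := n ^ 2 * η) (by positivity) ?_).trans_eq ?_
      · have := trace_mul_le_of_le (R := Matrix.of fun l k => residual h st (K l) (K k))
          (H := Matrix.of fun l k => h (K l) (K k)) hPt hPP hPG hPq hG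
          (fun v => hst.le (Fin n) K v) (by rw [hTr]; exact hp)
        rwa [hTr] at this
      · rw [ENNReal.ofReal_add (by positivity) (by positivity), ENNReal.ofReal_mul hθ]
    refine (expectation_mono h1).trans ?_
    rw [expectation_mul_add]
    -- The floor `2n²η` is the fixed point of the affine recursion, so the additive errors do not
    -- accumulate with `t`.
    refine (add_le_add_left (mul_le_mul_right (ih (Nat.le_of_succ_le ht)) _) _).trans ?_
    rw [← ENNReal.ofReal_mul hθ, ← ENNReal.ofReal_add (by positivity) (by positivity)]
    refine ENNReal.ofReal_le_ofReal (le_of_eq ?_)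
    rw [pow_succ]
    ring

end Rounds

/-! ### Matrix norms and stability of clipped averages -/

section Norms

variable {m d : ℕ}

theorem abs_le_maxNorm (A : Matrix (Fin m) (Fin d) ℝ) (i : Fin m) (j : Fin d) :
    |A i j| ≤ maxNorm A :=
  le_ciSup (f := fun ij : Fin m × Fin d => |A ij.1 ij.2|) (Set.finite_range _).bddAbove (i, j)

theorem maxNorm_nonneg (A : Matrix (Fin m) (Fin d) ℝ) : 0 ≤ maxNorm A :=
  Real.iSup_nonneg fun _ => abs_nonneg _

theorem maxNorm_le {A : Matrix (Fin m) (Fin d) ℝ} {B : ℝ} (hB : 0 ≤ B) (h : ∀ i j, |A i j| ≤ B) :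
    maxNorm A ≤ B :=
  Real.iSup_le (fun _ => h _ _) hB

theorem rowNorm_nonneg (A : Matrix (Fin m) (Fin d) ℝ) : 0 ≤ rowNorm A :=
  Real.iSup_nonneg fun _ => Real.sqrt_nonneg _

theorem abs_dotProduct_le {m' : ℕ} (A : Matrix (Fin m) (Fin d) ℝ) (B : Matrix (Fin m') (Fin d) ℝ)
    (i : Fin m) (j : Fin m') : |A i ⬝ᵥ B j| ≤ rowNorm A * rowNorm B := by
  have h1 : ∀ {k : ℕ} (A : Matrix (Fin k) (Fin d) ℝ) i, √(∑ j, A i j ^ 2) ≤ rowNorm A :=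
    fun A i => le_ciSup (f := fun i => √(∑ j, A i j ^ 2)) (Set.finite_range _).bddAbove i
  have h2 : |A i ⬝ᵥ B j| ≤ √(∑ k, A i k ^ 2) * √(∑ k, B j k ^ 2) := by
    rw [← Real.sqrt_mul (Finset.sum_nonneg fun _ _ => sq_nonneg _), ← Real.sqrt_sq_eq_abs]
    exact Real.sqrt_le_sqrt (Finset.sum_mul_sq_le_sq_mul_sq _ _ _)
  exact h2.trans (mul_le_mul (h1 A i) (h1 B j) (Real.sqrt_nonneg _) (rowNorm_nonneg A))

end Norms

/-- Perturbing the weights of a weighted average changes the clipped average by little. -/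
theorem abs_average_sub_clip_le {n : ℕ} {A e V : Fin n → ℝ} {v lo hi κ : ℝ} (hn : 0 < n)
    (hA : ∀ l, 0 ≤ A l) (hAn : (n : ℝ) ≤ ∑ l, A l) (hV : ∀ l, |V l| ≤ v)
    (hlo : ∀ l, lo ≤ V l) (hhi : ∀ l, V l ≤ hi) (hlo' : -v ≤ lo) (hhi' : hi ≤ v) (hκ : 0 < κ)
    {u : ℝ} (hu : 0 < κ * ∑ l, (A l - e l) →
      u = (κ * ∑ l, (A l - e l) * V l) / (κ * ∑ l, (A l - e l))) :
    |(∑ l, A l * V l) / (∑ l, A l) - max lo (min u hi)| ≤ 4 * v * ((∑ l, |e l|) / n) := by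
  have hn' : (0 : ℝ) < n := by exact_mod_cast hn
  set D := ∑ l, A l with hD
  set E := ∑ l, |e l| with hE
  have hD0 : 0 < D := hn'.trans_le hAn
  have hE0 : 0 ≤ E := Finset.sum_nonneg fun _ _ => abs_nonneg _
  have hv0 : 0 ≤ v := (abs_nonneg _).trans (hV ⟨0, hn⟩)
  set O := (∑ l, A l * V l) / D with hO
  have hOD : O * D = ∑ l, A l * V l := div_mul_cancel₀ _ hD0.ne'
  have hOlo : lo ≤ O := by
    rw [hO, le_div_iff₀ hD0, hD, Finset.mul_sum]
    exact Finset.sum_le_sum fun l _ => by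
      rw [mul_comm]; exact mul_le_mul_of_nonneg_left (hlo l) (hA l)
  have hOhi : O ≤ hi := by
    rw [hO, div_le_iff₀ hD0, hD, Finset.mul_sum]
    exact Finset.sum_le_sum fun l _ => by
      rw [mul_comm hi]; exact mul_le_mul_of_nonneg_left (hhi l) (hA l)
  have hOv : |O| ≤ v := abs_le.2 ⟨by linarith, by linarith⟩
  have hlohi : lo ≤ hi := hOlo.trans hOhi
  have h4 : 4 * v * (E / D) ≤ 4 * v * (E / n) := by
    have := div_le_div_of_nonneg_left hE0 hn' hAn
    exact mul_le_mul_of_nonneg_left this (by positivity)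
  refine le_trans ?_ h4
  -- If the perturbation is at least half the denominator, the trivial bound `2v` is enough.
  -- Otherwise the perturbed denominator is at least `D / 2`, so the value of `u` for a nonpositive
  -- denominator plays no role.
  rcases le_or_gt (D / 2) E with h5 | h5
  · have h6 : 1 / 2 ≤ E / D := by rw [le_div_iff₀ hD0]; linarith
    have h7 : |O - max lo (min u hi)| ≤ 2 * v := by
      have h8 : lo ≤ max lo (min u hi) := le_max_left _ _
      have h9 : max lo (min u hi) ≤ hi := max_le hlohi (min_le_right _ _)
      rw [abs_le]
      constructor <;> linarith
    nlinarith
  · have hDe : D / 2 ≤ ∑ l, (A l - e l) := by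
      rw [Finset.sum_sub_distrib]
      have : ∑ l, e l ≤ E := Finset.sum_le_sum fun l _ => le_abs_self _
      linarith
    set D' := ∑ l, (A l - e l) with hD'
    have hD'0 : 0 < D' := by linarith
    have hu' := hu (by positivity)
    rw [mul_div_mul_left _ _ hκ.ne'] at hu'
    have h6 : |O - max lo (min u hi)| ≤ |O - u| := by
      rcases le_total u lo with h | h
      · rw [min_eq_left (h.trans hlohi), max_eq_left h, abs_of_nonneg (by linarith),
          abs_of_nonneg (by linarith)]
        linarith
      · rcases le_total u hi with h' | h'
        · rw [min_eq_left h', max_eq_right h]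
        · rw [min_eq_right h', max_eq_right hlohi, abs_of_nonpos (by linarith),
            abs_of_nonpos (by linarith)]
          linarith
    refine h6.trans ?_
    have h7 : (O - u) * D' = ∑ l, e l * (V l - O) := by
      rw [hu', sub_mul, div_mul_cancel₀ _ hD'0.ne']
      have e1 : ∑ l, (A l - e l) * V l = O * D - ∑ l, e l * V l := by
        rw [hOD, ← Finset.sum_sub_distrib]
        exact Finset.sum_congr rfl fun l _ => by ring
      have e2 : D' = D - ∑ l, e l := by rw [hD', Finset.sum_sub_distrib]
      have e3 : ∑ l, e l * (V l - O) = (∑ l, e l * V l) - O * ∑ l, e l := by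
        rw [Finset.mul_sum, ← Finset.sum_sub_distrib]
        exact Finset.sum_congr rfl fun l _ => by ring
      rw [e1, e2, e3]; ring
    have h8 : |O - u| * D' ≤ 2 * v * E := by
      have h10 : |O - u| * D' = |(O - u) * D'| := by rw [abs_mul, abs_of_pos hD'0]
      rw [h10, h7, hE, Finset.mul_sum]
      refine (Finset.abs_sum_le_sum_abs _ _).trans (Finset.sum_le_sum fun l _ => ?_)
      rw [abs_mul, mul_comm]
      refine mul_le_mul_of_nonneg_right ?_ (abs_nonneg _)
      have := abs_sub (V l) O
      linarith [hV l]
    have h9 : |O - u| * (D / 2) ≤ 2 * v * E :=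
      (mul_le_mul_of_nonneg_left hDe (abs_nonneg _)).trans h8
    rw [mul_div_assoc', le_div_iff₀ hD0]
    linarith

/-! ### From the residual trace to the attention error -/

section Attention

variable {m n d r : ℕ}

theorem sum_recenter (K : Matrix (Fin n) (Fin d) ℝ) (hn : 0 < n) (j : Fin d) :
    ∑ l, recenter K l j = 0 := by
  have hn' : (n : ℝ) ≠ 0 := by exact_mod_cast hn.ne'
  simp only [recenter, Matrix.of_apply, rowMean, Finset.sum_sub_distrib, Finset.sum_const,
    Finset.card_univ, Fintype.card_fin, nsmul_eq_mul]
  field_simp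
  ring

/-- Since `exp t ≥ 1 + t` and the recentred exponents sum to zero. -/
theorem le_sum_expKernel_recenter (K : Matrix (Fin n) (Fin d) ℝ) (hn : 0 < n) (β : ℝ)
    (q : Fin d → ℝ) : (n : ℝ) ≤ ∑ l, expKernel β q (recenter K l) := by
  have h1 : ∑ l, (β * (q ⬝ᵥ recenter K l) + 1) = n := by
    rw [Finset.sum_add_distrib, ← Finset.mul_sum]
    have : ∑ l, q ⬝ᵥ recenter K l = 0 := by
      simp only [dotProduct]
      rw [Finset.sum_comm]
      refine Finset.sum_eq_zero fun j _ => ?_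
      rw [← Finset.mul_sum, sum_recenter K hn, mul_zero]
    rw [this]; simp
  rw [← h1]
  exact Finset.sum_le_sum fun l _ => Real.add_one_le_exp _

theorem expKernel_add (β : ℝ) (q x y : Fin d → ℝ) :
    expKernel β q (fun j => x j + y j) = expKernel β q y * expKernel β q x := by
  have : (fun j => x j + y j) = x + y := rfl
  rw [expKernel, expKernel, expKernel, ← Real.exp_add, this, dotProduct_add]
  ring_nf

theorem expKernel_div_smul {β θ : ℝ} (hθ : θ ≠ 0) (q x : Fin d → ℝ) :
    expKernel (β / θ) (θ • q) x = expKernel β q x := by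
  rw [expKernel, expKernel, smul_dotProduct, smul_eq_mul]
  congr 1
  field_simp

theorem IsValid.sum_weights {h : (Fin d → ℝ) → (Fin d → ℝ) → ℝ} {K : Matrix (Fin n) (Fin d) ℝ}
    {t : ℕ} {st : RPNysState n d r} (hst : IsValid h K t st) (x : Fin d → ℝ) (l : Fin n) :
    ∑ a, h x (st.KS a) * (st.M * st.R) a l = h x (K l) - residual h st x (K l) := by
  rw [residual, sub_sub_cancel]
  refine Finset.sum_congr rfl fun a _ => ?_
  rw [Matrix.mul_apply, Finset.mul_sum]
  refine Finset.sum_congr rfl fun b _ => ?_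
  rcases hst.slot b with h1 | h1
  · rw [(h1 a).2]; ring
  · rw [h1.2]; ring

/-- The error of the attention matrix computed from a state of RPNys, in terms of the trace of the
residual. -/
theorem maxNorm_sub_wtdAttn_le (hn : 0 < n) {β θ b lam : ℝ} (hθ : 0 < θ) (hlam : 0 < lam)
    {Q : Matrix (Fin m) (Fin d) ℝ} {K V : Matrix (Fin n) (Fin d) ℝ}
    (hb : ∀ i, β * θ * (Q i ⬝ᵥ Q i) ≤ b) {t : ℕ} {st : RPNysState n d r}
    (hst : IsValid (expKernel (β / θ)) (recenter K) t st) :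
    maxNorm (softmaxAttention β Q K V -
      wtdAttn Q (Matrix.of fun i j => st.KS i j + rowMean K j) (st.M * st.R * V)
        (fun i => ∑ l, (st.M * st.R) i l) (fun j => ⨅ l, V l j) (fun j => ⨆ l, V l j) β) ≤
      2 * maxNorm V * (Real.exp b * (∑ l, st.p l) / (n * lam) + lam) := by
  have hn' : (0 : ℝ) < n := by exact_mod_cast hn
  have : Nonempty (Fin n) := ⟨⟨0, hn⟩⟩
  have hT0 : 0 ≤ ∑ l, st.p l := Finset.sum_nonneg fun l _ => hst.p_nonneg l
  have hv0 := maxNorm_nonneg V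
  refine maxNorm_le (by positivity) fun i j => ?_
  set e : Fin n → ℝ := fun l => residual (expKernel (β / θ)) st (θ • Q i) (recenter K l) with he
  set A : Fin n → ℝ := fun l => expKernel β (Q i) (recenter K l) with hA
  set κ := expKernel β (Q i) (rowMean K) with hκ
  have hκ0 : 0 < κ := Real.exp_pos _
  have hKl : ∀ l, expKernel β (Q i) (K l) = κ * A l := by
    intro l
    rw [hκ, hA, ← expKernel_add]
    congr 1
    funext j
    simp [recenter]
  have hW : ∀ f : Fin n → ℝ, ∑ a, expKernel β (Q i)
      ((Matrix.of fun i j => st.KS i j + rowMean K j) a) * ∑ l, (st.M * st.R) a l * f l =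
      κ * ∑ l, (A l - e l) * f l := by
    intro f
    have h1 : ∀ l, A l - e l = ∑ a, expKernel β (Q i) (st.KS a) * (st.M * st.R) a l := by
      intro l
      have := hst.sum_weights (θ • Q i) l
      simp only [expKernel_div_smul hθ.ne'] at this
      exact this.symm
    simp_rw [h1, Finset.mul_sum, Finset.sum_mul, Finset.mul_sum]
    rw [Finset.sum_comm]
    refine Finset.sum_congr rfl fun l _ => Finset.sum_congr rfl fun a _ => ?_
    have h2 : expKernel β (Q i) ((Matrix.of fun i j => st.KS i j + rowMean K j) a) =
        κ * expKernel β (Q i) (st.KS a) := expKernel_add β (Q i) (st.KS a) (rowMean K)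
    rw [h2]; ring
  have hden : ∑ a, expKernel β (Q i) ((Matrix.of fun i j => st.KS i j + rowMean K j) a) *
      ∑ l, (st.M * st.R) a l = κ * ∑ l, (A l - e l) := by
    simpa using hW fun _ => 1
  have hnum : ∑ a, expKernel β (Q i) ((Matrix.of fun i j => st.KS i j + rowMean K j) a) *
      (st.M * st.R * V) a j = κ * ∑ l, (A l - e l) * V l j := by
    rw [← hW]
    exact Finset.sum_congr rfl fun a _ => by rw [Matrix.mul_apply]
  have hO : softmaxAttention β Q K V i j = (∑ l, A l * V l j) / ∑ l, A l := by
    simp only [softmaxAttention, Matrix.of_apply, hKl, mul_assoc, ← Finset.mul_sum]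
    rw [mul_div_mul_left _ _ hκ0.ne']
  have hVb : ∀ l, |V l j| ≤ maxNorm V := fun l => abs_le_maxNorm V l j
  have key := abs_average_sub_clip_le (A := A) (e := e) (V := fun l => V l j) (v := maxNorm V)
    (lo := ⨅ l, V l j) (hi := ⨆ l, V l j) (κ := κ) hn (fun l => (Real.exp_pos _).le)
    (le_sum_expKernel_recenter K hn β (Q i)) hVb
    (fun l => ciInf_le (Set.finite_range _).bddBelow l)
    (fun l => le_ciSup (f := fun l => V l j) (Set.finite_range _).bddAbove l)
    (le_ciInf fun l => (abs_le.1 (hVb l)).1) (ciSup_le fun l => (abs_le.1 (hVb l)).2) hκ0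
    (u := if 0 < κ * ∑ l, (A l - e l) then
      (κ * ∑ l, (A l - e l) * V l j) / (κ * ∑ l, (A l - e l)) else 0) (fun h => if_pos h)
  rw [Matrix.sub_apply, hO]
  have hO' : wtdAttn Q (Matrix.of fun i j => st.KS i j + rowMean K j) (st.M * st.R * V)
      (fun i => ∑ l, (st.M * st.R) i l) (fun j => ⨅ l, V l j) (fun j => ⨆ l, V l j) β i j =
      max (⨅ l, V l j) (min (if 0 < κ * ∑ l, (A l - e l) then
        (κ * ∑ l, (A l - e l) * V l j) / (κ * ∑ l, (A l - e l)) else 0) (⨆ l, V l j)) := by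
    rw [← hden, ← hnum]
    rfl
  rw [hO']
  have hE : ∑ l, |e l| ≤ (Real.exp b * (∑ l, st.p l) / lam + n * lam) / 2 := by
    -- Cauchy–Schwarz for the residual gives `e l ^ 2 ≤ exp b * p l`. The inequality of arithmetic
    -- and geometric means with weight `lam` removes the square root, leaving a bound linear in `p`
    -- whose expectation is available.
    have h1 : ∀ l, |e l| ≤ (Real.exp b / lam * st.p l + lam) / 2 := by
      intro l
      have h2 : e l ^ 2 ≤ Real.exp b * st.p l := by
        refine (hst.psd.sq_le _ _).trans ?_
        rw [← hst.diag]
        refine mul_le_mul_of_nonneg_right ?_ (hst.p_nonneg l)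
        have h3 := hst.le Unit (fun _ => θ • Q i) (fun _ => 1)
        simp only [Finset.univ_unique, Finset.sum_singleton, one_mul] at h3
        refine h3.trans ?_
        rw [expKernel_div_smul hθ.ne', expKernel, dotProduct_smul, smul_eq_mul]
        refine Real.exp_le_exp.2 ((le_of_eq ?_).trans (hb i))
        ring
      have h4 : 0 ≤ (|e l| - lam) ^ 2 := sq_nonneg _
      rw [sub_sq, sq_abs] at h4
      have h5 : |e l| * (2 * lam) ≤ Real.exp b * st.p l + lam * lam := by nlinarith
      have h6 : (Real.exp b / lam * st.p l + lam) / 2 =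
          (Real.exp b * st.p l + lam * lam) / (2 * lam) := by field_simp
      rw [h6, le_div_iff₀ (by positivity)]
      exact h5
    refine (Finset.sum_le_sum fun l _ => h1 l).trans (le_of_eq ?_)
    rw [← Finset.sum_div, Finset.sum_add_distrib, ← Finset.mul_sum]
    simp
    ring
  calc _ ≤ 4 * maxNorm V * ((∑ l, |e l|) / n) := key
    _ ≤ 4 * maxNorm V * (((Real.exp b * (∑ l, st.p l) / lam + n * lam) / 2) / n) := by gcongr
    _ = _ := by field_simp; ring

end Attention

/-! ### The Lambert function and the temperature -/

section Temperature

theorem lambertW_mul_exp {z : ℝ} (hz : 0 ≤ z) : lambertW z * Real.exp (lambertW z) = z := by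
  have hex : ∃ w ∈ Set.Ici (-1 : ℝ), (fun w : ℝ => w * Real.exp w) w = z := by
    have hc : ContinuousOn (fun w : ℝ => w * Real.exp w) (Set.Icc 0 z) := by fun_prop
    have hz' : z ∈ Set.Icc ((0 : ℝ) * Real.exp 0) (z * Real.exp z) := by
      refine ⟨by simpa using hz, ?_⟩
      nlinarith [Real.one_le_exp hz]
    obtain ⟨w, hw, h⟩ := intermediate_value_Icc hz hc hz'
    exact ⟨w, by have := hw.1; simp only [Set.mem_Ici]; linarith, h⟩
  exact Function.invFunOn_eq hex

theorem lambertW_pos {z : ℝ} (hz : 0 < z) : 0 < lambertW z := by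
  have h := lambertW_mul_exp hz.le
  by_contra hw
  have : lambertW z * Real.exp (lambertW z) ≤ 0 :=
    mul_nonpos_of_nonpos_of_nonneg (not_lt.1 hw) (Real.exp_pos _).le
  linarith

theorem one_le_rhoZero : 1 ≤ rhoZero := by
  rw [rhoZero, Real.one_le_sqrt]
  linarith [Real.exp_pos (lambertW (2 / Real.exp 2) + 2)]

/-- The argument of the Lambert function in the temperature, as a function of `γ`. -/
noncomputable def lambertArg (γ : ℝ) : ℝ := (1 / γ + 2) / (2 * rhoZero)

/-- The square of the temperature is `RK / RQ` times this quantity. -/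
noncomputable def tempScale (γ : ℝ) : ℝ := rhoZero * Real.exp (lambertW (lambertArg γ))

theorem lambertArg_pos {γ : ℝ} (hγ : 0 < γ) : 0 < lambertArg γ := by
  have := one_le_rhoZero
  unfold lambertArg
  positivity

theorem tempScale_mul_lambertW {γ : ℝ} (hγ : 0 < γ) :
    tempScale γ * lambertW (lambertArg γ) = (1 / γ + 2) / 2 := by
  have h := lambertW_mul_exp (lambertArg_pos hγ).le
  have h1 : 0 < rhoZero := by linarith [one_le_rhoZero]
  rw [tempScale, mul_assoc, mul_comm (Real.exp _), h, lambertArg]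
  field_simp

theorem one_le_tempScale {γ : ℝ} (hγ : 0 < γ) : 1 ≤ tempScale γ := by
  have h1 := one_le_rhoZero
  have h2 := Real.one_le_exp (lambertW_pos (lambertArg_pos hγ)).le
  rw [tempScale]
  nlinarith

theorem temperature_sq {β RQ RK γ : ℝ} {n : ℕ} (hn : 2 ≤ n) (hRQ : 0 < RQ) (hRK : 0 < RK)
    (hγ : 0 < γ) (h : β * RQ * RK / Real.log n = γ) :
    temperature β RQ RK n ^ 2 = RK / RQ * tempScale γ := by
  have hL : 0 < Real.log n := Real.log_pos (by exact_mod_cast hn)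
  have h1 : Real.log n / (β * RQ * RK) + 2 = 1 / γ + 2 := by rw [← h, one_div_div]
  have hw := lambertW_pos (lambertArg_pos hγ)
  have h2 : (1 / γ + 2) / (2 * lambertW (lambertArg γ)) = tempScale γ := by
    rw [div_eq_iff (by positivity)]
    have := tempScale_mul_lambertW hγ
    linarith
  have h3 : (1 : ℝ) ≤ tempScale γ := one_le_tempScale hγ
  have h4 : temperature β RQ RK n = √(RK / RQ * tempScale γ) := by
    rw [← h2, lambertArg]
    simp only [temperature, h1]
  rw [h4, Real.sq_sqrt (by positivity)]

/-- For small `γ` the scale is at most `3 / (2 γ)`. -/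
theorem mul_tempScale_le_of_small {γ : ℝ} (hγ : 0 < γ) (hγ1 : γ ≤ 1)
    (h : Real.exp 1 ≤ lambertArg γ) : γ * tempScale γ ≤ 3 / 2 := by
  have hw : 1 ≤ lambertW (lambertArg γ) := by
    by_contra hlt
    rw [not_le] at hlt
    have h1 := lambertW_mul_exp (lambertArg_pos hγ).le
    have h2 := lambertW_pos (lambertArg_pos hγ)
    have h3 : Real.exp (lambertW (lambertArg γ)) < Real.exp 1 := Real.exp_lt_exp.2 hlt
    nlinarith [Real.exp_pos (lambertW (lambertArg γ))]
  have h1 := tempScale_mul_lambertW hγ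
  have h2 := one_le_tempScale hγ
  have h3 : tempScale γ ≤ (1 / γ + 2) / 2 := by rw [← h1]; nlinarith
  calc γ * tempScale γ ≤ γ * ((1 / γ + 2) / 2) := by gcongr
    _ = (1 + 2 * γ) / 2 := by field_simp
    _ ≤ 3 / 2 := by linarith

/-- From `W(z) ≤ z` for positive `z`. The bound is crude but uniform in `γ ≥ c`, which is all the
second regime needs. -/
theorem tempScale_le {γ c : ℝ} (hc : 0 < c) (hγ : c ≤ γ) :
    tempScale γ ≤ rhoZero * Real.exp (1 / c + 2) := by
  have h1 := one_le_rhoZero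
  have hγ0 := hc.trans_le hγ
  have h2 := lambertW_mul_exp (lambertArg_pos hγ0).le
  have h3 := lambertW_pos (lambertArg_pos hγ0)
  have h4 := Real.one_le_exp h3.le
  have h5 : lambertW (lambertArg γ) ≤ lambertArg γ := by nlinarith
  have h6 : lambertArg γ ≤ 1 / c + 2 := by
    have h7 : 1 / γ ≤ 1 / c := one_div_le_one_div_of_le hc hγ
    have h8 : 0 < 1 / γ := by positivity
    rw [lambertArg, div_le_iff₀ (by linarith)]
    nlinarith
  rw [tempScale]
  gcongr
  linarith

end Temperature

/-! ### Sufficient conditions on the rank parameter -/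

section ErrorBound

variable {m n d : ℕ}

/-- With `lam = n^(-a)` the error bound splits into `2 ‖V‖ lam` and a multiple of the expected
trace. The budget `Z` pays for `exp b`, for `lam²`, for the initial trace `n exp x`, and for the
powers of `n`, and brings the second part below `‖V‖ lam`. -/
theorem expectation_wildcat_le_of_rank {β θ b x ρ Z a : ℝ} (hn : 2 ≤ n)
    {Q : Matrix (Fin m) (Fin d) ℝ} {K V : Matrix (Fin n) (Fin d) ℝ} (hβ : 0 < β) (hθ : 0 < θ)
    (hτ : temperature β (rowNorm Q) (rowNorm (recenter K)) n ^ 2 = θ)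
    (hb : ∀ i, β * θ * (Q i ⬝ᵥ Q i) ≤ b)
    (hx : ∀ i j, |β / θ * (recenter K i ⬝ᵥ recenter K j)| ≤ x) (hρ : 1 ≤ ρ) (s r : ℕ)
    (hZ : b + 2 * a * Real.log n + x + 4 * Real.log n ≤ Z)
    (htail : Real.exp (ρ * x) / ρ ^ (s + 1) ≤ Real.exp (-Z))
    (hr : ((d + s).choose s : ℕ) * Z ≤ r) :
    expectation (wildcat Q K V β r)
        (fun O' => ENNReal.ofReal (maxNorm (softmaxAttention β Q K V - O'))) ≤
      ENNReal.ofReal (3 * maxNorm V * (n : ℝ) ^ (-a)) := by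
  have hn0 : 0 < n := by omega
  have hn' : (2 : ℝ) ≤ n := by exact_mod_cast hn
  have hv := maxNorm_nonneg V
  have hh : IsPSDKernel (expKernel (d := d) (β / θ)) := isPSDKernel_expKernel (by positivity)
  have hq : (1 : ℝ) ≤ ((d + s).choose s : ℕ) := by
    exact_mod_cast Nat.choose_pos (Nat.le_add_left s d)
  set q : ℝ := (((d + s).choose s : ℕ) : ℝ) with hq_def
  have hlam : (0 : ℝ) < (n : ℝ) ^ (-a) := Real.rpow_pos_of_pos (by linarith) _
  set lam := (n : ℝ) ^ (-a) with hlam_def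
  obtain ⟨P, G, h1, h2, h3, h4, h5⟩ := exists_projection_expKernel (recenter K) hx hρ s
  have hE := expectation_rounds_le (r := r) hh hq (Real.exp_pos (-Z)).le h1 h2 h3 h4
    (fun i j => (h5 i j).trans htail) r le_rfl
  have e1 : expectation (wildcat Q K V β r)
        (fun O' => ENNReal.ofReal (maxNorm (softmaxAttention β Q K V - O'))) =
      expectation (rpnysRounds (expKernel (β / θ)) (recenter K) r r le_rfl) fun st =>
        ENNReal.ofReal (maxNorm (softmaxAttention β Q K V -
          wtdAttn Q (Matrix.of fun i j => st.KS i j + rowMean K j) (st.M * st.R * V)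
        (fun i => ∑ l, (st.M * st.R) i l) (fun j => ⨅ l, V l j) (fun j => ⨆ l, V l j) β)) := by
    rw [wildcat, expectation_map, compressKV]
    simp only [hτ]
    rw [expectation_map, rpnys, expectation_map]
    rfl
  rw [e1]
  set c := 2 * maxNorm V * (Real.exp b / (n * lam)) with hc
  have hc0 : 0 ≤ c := by positivity
  have e2 : ∀ st ∈ (rpnysRounds (expKernel (β / θ)) (recenter K) r r le_rfl).support,
      ENNReal.ofReal (maxNorm (softmaxAttention β Q K V -
          wtdAttn Q (Matrix.of fun i j => st.KS i j + rowMean K j) (st.M * st.R * V)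
        (fun i => ∑ l, (st.M * st.R) i l) (fun j => ⨅ l, V l j) (fun j => ⨆ l, V l j) β)) ≤
      ENNReal.ofReal c * ENNReal.ofReal (∑ l, st.p l) +
        ENNReal.ofReal (2 * maxNorm V * lam) := by
    intro st hs
    have hst := isValid_of_mem_support hh r _ hs
    have hT0 : 0 ≤ ∑ l, st.p l := Finset.sum_nonneg fun l _ => hst.p_nonneg l
    rw [← ENNReal.ofReal_mul hc0, ← ENNReal.ofReal_add (by positivity) (by positivity)]
    refine ENNReal.ofReal_le_ofReal ((maxNorm_sub_wtdAttn_le hn0 hθ hlam hb hst).trans_eq ?_)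
    rw [hc]; ring
  refine (expectation_mono e2).trans ?_
  rw [expectation_mul_add]
  refine (add_le_add_left (mul_le_mul_right hE _) _).trans ?_
  have hT0 : 0 ≤ ∑ l, expKernel (β / θ) (recenter K l) (recenter K l) :=
    Finset.sum_nonneg fun l _ => hh.diag_nonneg _
  have hq1 : 0 ≤ 1 - 1 / q := by
    have : 1 / q ≤ 1 := by rw [div_le_one (by linarith)]; exact hq
    linarith
  rw [← ENNReal.ofReal_mul hc0, ← ENNReal.ofReal_add (by positivity) (by positivity)]
  refine ENNReal.ofReal_le_ofReal ?_
  have hT1 : ∑ l, expKernel (β / θ) (recenter K l) (recenter K l) ≤ n * Real.exp x := by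
    calc _ ≤ ∑ l : Fin n, Real.exp x :=
          Finset.sum_le_sum fun l _ => Real.exp_le_exp.2 ((le_abs_self _).trans (hx l l))
      _ = n * Real.exp x := by simp
  have hpow : (1 - 1 / q) ^ r ≤ Real.exp (-Z) := by
    calc (1 - 1 / q) ^ r ≤ Real.exp (-(1 / q)) ^ r :=
          pow_le_pow_left₀ hq1 (Real.one_sub_le_exp_neg _) r
      _ = Real.exp (-(r / q)) := by rw [← Real.exp_nat_mul]; congr 1; ring
      _ ≤ Real.exp (-Z) := by
          refine Real.exp_le_exp.2 (neg_le_neg ?_)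
          rw [le_div_iff₀ (by linarith), mul_comm]
          exact hr
  have hx0 : 0 ≤ x := (abs_nonneg _).trans (hx ⟨0, hn0⟩ ⟨0, hn0⟩)
  have hlamexp : lam = Real.exp (-(a * Real.log n)) := by
    rw [hlam_def, Real.rpow_def_of_pos (by linarith)]; congr 1; ring
  have hnexp : Real.exp (4 * Real.log n) = (n : ℝ) ^ 4 := by
    rw [show (4 : ℝ) * Real.log n = ((4 : ℕ) : ℝ) * Real.log n by norm_num, Real.exp_nat_mul,
      Real.exp_log (by linarith)]
  have hmain : Real.exp b * ((1 - 1 / q) ^ r *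
      (∑ l, expKernel (β / θ) (recenter K l) (recenter K l)) + 2 * (n ^ 2 * Real.exp (-Z))) ≤
      n * lam * (lam / 2) := by
    have g1 : (1 - 1 / q) ^ r * (∑ l, expKernel (β / θ) (recenter K l) (recenter K l)) +
        2 * (n ^ 2 * Real.exp (-Z)) ≤ n * (1 + 2 * n) * (Real.exp x * Real.exp (-Z)) := by
      have g2 := mul_le_mul hpow hT1 hT0 (Real.exp_pos _).le
      have g3 : n ^ 2 * Real.exp (-Z) ≤ n ^ 2 * (Real.exp x * Real.exp (-Z)) := by
        have := Real.one_le_exp hx0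
        gcongr
        nlinarith [Real.exp_pos (-Z)]
      nlinarith
    have g4 : Real.exp b * (Real.exp x * Real.exp (-Z)) ≤ lam * lam / (n : ℝ) ^ 4 := by
      rw [hlamexp, ← hnexp, ← Real.exp_add, ← Real.exp_add, ← Real.exp_add, ← Real.exp_sub]
      refine Real.exp_le_exp.2 ?_
      linarith
    have g5 : (1 + 2 * n : ℝ) / (n : ℝ) ^ 4 ≤ 1 / 2 := by
      rw [div_le_iff₀ (by positivity)]
      nlinarith [pow_le_pow_left₀ (by norm_num) hn' 3, pow_pos (show (0 : ℝ) < n by linarith) 3]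
    calc _ ≤ Real.exp b * (n * (1 + 2 * n) * (Real.exp x * Real.exp (-Z))) := by gcongr
      _ = n * (1 + 2 * n) * (Real.exp b * (Real.exp x * Real.exp (-Z))) := by ring
      _ ≤ n * (1 + 2 * n) * (lam * lam / (n : ℝ) ^ 4) := by gcongr
      _ = n * (lam * lam) * ((1 + 2 * n) / (n : ℝ) ^ 4) := by ring
      _ ≤ n * (lam * lam) * (1 / 2) := by gcongr
      _ = _ := by ring
  have hfin : Real.exp b / (n * lam) * ((1 - 1 / q) ^ r *
      (∑ l, expKernel (β / θ) (recenter K l) (recenter K l)) + 2 * (n ^ 2 * Real.exp (-Z))) ≤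
      lam / 2 := by
    rw [div_mul_eq_mul_div, div_le_iff₀ (by positivity)]
    linarith
  have := mul_le_mul_of_nonneg_left hfin (show 0 ≤ 2 * maxNorm V by positivity)
  rw [hc]
  linarith

/-- The rank parameter `r` guarantees the error bound for all inputs of the given size. -/
def IsGoodRank (n d : ℕ) (γ a : ℝ) (r : ℕ) : Prop :=
  ∀ (m : ℕ) (β : ℝ) (Q : Matrix (Fin m) (Fin d) ℝ) (K V : Matrix (Fin n) (Fin d) ℝ), 0 < β →
    β * rowNorm Q * rowNorm (recenter K) / Real.log n = γ →
    expectation (wildcat Q K V β r)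
        (fun O' => ENNReal.ofReal (maxNorm (softmaxAttention β Q K V - O'))) ≤
      ENNReal.ofReal (3 * maxNorm V * (n : ℝ) ^ (-a))

/-- As `τ² = (R_K / R_Q) tempScale γ`, the exponents at the scaled queries are at most `γ log n ·
tempScale γ`. Those between keys are at most `γ log n / tempScale γ ≤ γ log n`. Hence the conditions
depend only on `n`, `d`, `γ` and `a`. -/
theorem isGoodRank {γ a ρ Z : ℝ} (hn : 2 ≤ n) (hγ : 0 < γ) (hρ : 1 ≤ ρ) {s r : ℕ}
    (hZ : (γ * tempScale γ + 2 * a + γ + 4) * Real.log n ≤ Z)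
    (htail : ρ * γ * Real.log n + Z ≤ (s + 1) * Real.log ρ)
    (hr : ((d + s).choose s : ℕ) * Z ≤ r) : IsGoodRank n d γ a r := by
  intro m β Q K V hβ h
  have hL : 0 < Real.log n := Real.log_pos (by exact_mod_cast hn)
  have hB : β * rowNorm Q * rowNorm (recenter K) = γ * Real.log n := by
    rw [← h]; field_simp
  have hB0 : 0 < β * rowNorm Q * rowNorm (recenter K) := by rw [hB]; positivity
  have hRK : 0 < rowNorm (recenter K) :=
    (rowNorm_nonneg _).lt_of_ne fun h0 => by rw [← h0, mul_zero] at hB0; exact hB0.false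
  have hRQ : 0 < rowNorm Q :=
    (rowNorm_nonneg _).lt_of_ne fun h0 => by rw [← h0, mul_zero, zero_mul] at hB0; exact hB0.false
  have ht := one_le_tempScale hγ
  have hρ0 : 0 < ρ := by linarith
  have hθ : 0 < rowNorm (recenter K) / rowNorm Q * tempScale γ := by positivity
  refine expectation_wildcat_le_of_rank (b := γ * Real.log n * tempScale γ)
    (x := γ * Real.log n) hn hβ hθ (temperature_sq hn hRQ hRK hγ h) (fun i => ?_)
    (fun i j => ?_) hρ s r (by linarith) ?_ hr
  · have h1 := (le_abs_self _).trans (abs_dotProduct_le Q Q i i)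
    calc _ ≤ β * (rowNorm (recenter K) / rowNorm Q * tempScale γ) * (rowNorm Q * rowNorm Q) := by
          gcongr
      _ = β * rowNorm Q * rowNorm (recenter K) * tempScale γ := by field_simp
      _ = _ := by rw [hB]
  · have h1 := abs_dotProduct_le (recenter K) (recenter K) i j
    rw [abs_mul, abs_of_pos (by positivity)]
    calc _ ≤ β / (rowNorm (recenter K) / rowNorm Q * tempScale γ) *
          (rowNorm (recenter K) * rowNorm (recenter K)) := by gcongr
      _ = β * rowNorm Q * rowNorm (recenter K) / tempScale γ := by field_simp
      _ ≤ β * rowNorm Q * rowNorm (recenter K) := div_le_self hB0.le ht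
      _ = _ := hB
  · have h1 : ρ ^ (s + 1) = Real.exp ((s + 1) * Real.log ρ) := by
      rw [show ((s : ℝ) + 1) = ((s + 1 : ℕ) : ℝ) by push_cast; ring, Real.exp_nat_mul,
        Real.exp_log hρ0]
    rw [h1, ← Real.exp_sub]
    refine Real.exp_le_exp.2 ?_
    linarith

theorem exists_isGoodRank {γ a : ℝ} (hn : 2 ≤ n) (hγ : 0 < γ) : ∃ r, IsGoodRank n d γ a r := by
  set Z := (γ * tempScale γ + 2 * a + γ + 4) * Real.log n with hZ
  obtain ⟨s, hs⟩ := exists_nat_ge (Real.exp 1 * γ * Real.log n + Z)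
  obtain ⟨r, hr⟩ := exists_nat_ge ((((d + s).choose s : ℕ) : ℝ) * Z)
  exact ⟨r, isGoodRank hn hγ (Real.one_le_exp zero_le_one) hZ.ge (s := s)
    (by rw [Real.log_exp]; linarith) hr⟩

end ErrorBound

/-! ### Logarithms of binomial coefficients -/

section Choose

theorem log_one_add_le_two_mul_sqrt {v : ℝ} (hv : 0 ≤ v) : Real.log (1 + v) ≤ 2 * √v := by
  have h1 : 1 + v ≤ (1 + √v) ^ 2 := by nlinarith [Real.sq_sqrt hv, Real.sqrt_nonneg v]
  have h2 : 0 < 1 + √v := by linarith [Real.sqrt_nonneg v]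
  calc Real.log (1 + v) ≤ Real.log ((1 + √v) ^ 2) := Real.log_le_log (by linarith) h1
    _ = 2 * Real.log (1 + √v) := by rw [Real.log_pow]; norm_num
    _ ≤ 2 * √v := by linarith [Real.log_le_sub_one_of_pos h2]

/-- From `(k+l choose k) ≤ (k+l)^k / k!` and `k^k / k! ≤ exp k`. -/
theorem log_choose_le {k : ℕ} (hk : 1 ≤ k) (l : ℕ) :
    Real.log ((k + l).choose k : ℕ) ≤ k * (1 + Real.log (1 + l / k)) := by
  have hk0 : (0 : ℝ) < k := by exact_mod_cast hk
  have hf : (0 : ℝ) < (k.factorial : ℝ) := by exact_mod_cast k.factorial_pos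
  have h1 := Nat.choose_le_pow_div (α := ℝ) k (k + l)
  have h2 := Real.pow_div_factorial_le_exp (k : ℝ) hk0.le k
  have h3 : (((k + l : ℕ) : ℝ) ^ k) / k.factorial ≤ Real.exp k * (1 + l / k) ^ k := by
    have : ((k + l : ℕ) : ℝ) = k * (1 + l / k) := by push_cast; field_simp
    rw [this, mul_pow, mul_div_right_comm]
    gcongr
  have h4 : (0 : ℝ) < ((k + l).choose k : ℕ) := by
    exact_mod_cast Nat.choose_pos (Nat.le_add_right k l)
  have h5 : (0 : ℝ) < 1 + l / k := by positivity
  calc _ ≤ Real.log (Real.exp k * (1 + l / k) ^ k) := Real.log_le_log h4 (h1.trans h3)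
    _ = k * (1 + Real.log (1 + l / k)) := by
      rw [Real.log_mul (Real.exp_pos _).ne' (by positivity), Real.log_exp, Real.log_pow]
      ring

/-- The number of monomials, when the degree is small compared with `L`. -/
theorem log_choose_le_of_degree_le {d s : ℕ} {L η δ : ℝ} (hL : 0 < L) (hη : 0 ≤ η)
    (hδ : δ = d / L) (hs : (s : ℝ) ≤ η * L) :
    Real.log ((d + s).choose s : ℕ) ≤ L * (2 * (η * max (Real.log δ) 1) + 2 * √η) := by
  rcases Nat.eq_zero_or_pos s with h0 | h0
  · subst h0
    simp only [Nat.choose_zero_right, Nat.cast_one, Real.log_one]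
    have : 0 ≤ max (Real.log δ) 1 := zero_le_one.trans (le_max_right _ _)
    positivity
  have hs0 : (0 : ℝ) < s := by exact_mod_cast h0
  have hd : (d : ℝ) = δ * L := by rw [hδ]; field_simp
  have hδ0 : 0 ≤ δ := by rw [hδ]; positivity
  set M := max (Real.log δ) 1 with hM
  have hM1 : 1 ≤ M := le_max_right _ _
  have hD1 : 1 ≤ max δ 1 := le_max_right _ _
  have hlogD : Real.log (max δ 1) ≤ M := by
    rcases max_cases δ 1 with h | h
    · rw [h.1]; exact le_max_left _ _
    · rw [h.1, Real.log_one]; linarith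
  have h1 : Real.log (1 + d / s) ≤ M + 2 * √(L / s) := by
    -- This separates the dimension from the degree: `log (max δ 1)` is at most `M`, and `s √(L/s) =
    -- √(sL)` tames the other factor.
    have h2 : 1 + d / s ≤ max δ 1 * (1 + L / s) := by
      rw [hd, mul_div_assoc]
      have : δ * (L / s) ≤ max δ 1 * (L / s) := by gcongr; exact le_max_left _ _
      linarith
    have h3 : (0 : ℝ) < 1 + d / s := by positivity
    have h4 : (0 : ℝ) < 1 + L / s := by positivity
    have h5 := Real.log_le_log h3 h2
    rw [Real.log_mul (by linarith) h4.ne'] at h5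
    have h6 := log_one_add_le_two_mul_sqrt (show 0 ≤ L / s by positivity)
    linarith
  have h7 : (s : ℝ) * √(L / s) ≤ L * √η := by
    have h8 : (s : ℝ) * √(L / s) = √(s * L) := by
      rw [Real.sqrt_div hL.le, Real.sqrt_mul hs0.le, mul_div_assoc', div_eq_iff (by positivity)]
      rw [mul_right_comm, Real.mul_self_sqrt hs0.le]
    have h9 : √(s * L) ≤ √(L ^ 2 * η) := Real.sqrt_le_sqrt (by nlinarith)
    rw [h8]
    refine h9.trans_eq ?_
    rw [Real.sqrt_mul (by positivity), Real.sqrt_sq hL.le]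
  have h10 := log_choose_le h0 d
  rw [add_comm s d] at h10
  have h11 : (s : ℝ) * (1 + Real.log (1 + d / s)) ≤ s * (1 + (M + 2 * √(L / s))) := by gcongr
  have h12 : (s : ℝ) * M ≤ η * L * M := by gcongr
  nlinarith

/-- The number of monomials, when the dimension is small compared with `L`. -/
theorem log_choose_le_of_dim {d s : ℕ} {L y δ : ℝ} (hL : 0 < L) (hd : 1 ≤ d) (hy : 0 ≤ y)
    (hδ : δ = d / L) (hs : (s : ℝ) ≤ y * L) :
    Real.log ((d + s).choose s : ℕ) ≤ L * (δ + δ * Real.log (1 + y) + 2 * √δ) := by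
  have hd0 : (0 : ℝ) < d := by exact_mod_cast hd
  have hdL : (d : ℝ) = δ * L := by rw [hδ]; field_simp
  have hδ0 : 0 < δ := by rw [hδ]; positivity
  have h1 : Real.log (1 + s / d) ≤ Real.log (1 + y) + 2 * √(1 / δ) := by
    have h2 : 1 + s / d ≤ (1 + y) * (1 + 1 / δ) := by
      have : (s : ℝ) / d ≤ y * (1 / δ) := by
        rw [hδ, one_div_div, mul_div_assoc']
        gcongr
      have h3 : 0 < 1 / δ := by positivity
      nlinarith
    have h3 : (0 : ℝ) < 1 + s / d := by positivity
    have h5 := Real.log_le_log h3 h2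
    rw [Real.log_mul (by positivity) (by positivity)] at h5
    have h6 := log_one_add_le_two_mul_sqrt (show 0 ≤ 1 / δ by positivity)
    linarith
  have h7 : δ * √(1 / δ) = √δ := by
    rw [Real.sqrt_div zero_le_one, Real.sqrt_one, mul_one_div, div_eq_iff (by positivity),
      Real.mul_self_sqrt hδ0.le]
  have h8 := log_choose_le hd s
  rw [Nat.choose_symm_add] at h8
  refine h8.trans ?_
  have h9 : (d : ℝ) * (1 + Real.log (1 + s / d)) ≤
      d * (1 + (Real.log (1 + y) + 2 * √(1 / δ))) := by gcongr
  refine h9.trans_eq ?_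
  rw [hdL, ← h7]
  ring

end Choose

/-! ### Calculus of `n^{o(1)}` -/

section Growth

theorem tendsto_log_natCast : Tendsto (fun n : ℕ => Real.log n) atTop atTop :=
  Real.tendsto_log_atTop.comp tendsto_natCast_atTop_atTop

/-- `f ∈ n^{o(1)}` for positive `f` with `log f = o(log n)`. -/
theorem inPowLittleO_of_tendsto {f : ℕ → ℝ} (hf : ∀ᶠ n in atTop, 0 < f n)
    (h : Tendsto (fun n => Real.log (f n) / Real.log n) atTop (𝓝 0)) :
    InPowLittleO f fun _ => 1 := by
  refine ⟨fun n => Real.log (f n) / Real.log n, (isLittleO_one_iff ℝ).2 h, ?_⟩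
  filter_upwards [hf, eventually_ge_atTop 2] with n h1 h2
  have hn : (2 : ℝ) ≤ n := by exact_mod_cast h2
  have hL : 0 < Real.log n := Real.log_pos (by linarith)
  rw [Real.rpow_def_of_pos (by linarith), mul_div_cancel₀ _ hL.ne', Real.exp_log h1]

theorem InPowLittleO.tendsto {f g : ℕ → ℝ} (hf : InPowLittleO f g) :
    Tendsto (fun n => Real.log (f n) / Real.log n / g n) atTop (𝓝 0) := by
  obtain ⟨e, he, hfe⟩ := hf
  refine (he.tendsto_div_nhds_zero).congr' ?_
  filter_upwards [hfe, eventually_ge_atTop 2] with n h1 h2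
  have hn : (2 : ℝ) ≤ n := by exact_mod_cast h2
  have hL : 0 < Real.log n := Real.log_pos (by linarith)
  rw [h1, Real.log_rpow (by linarith), mul_div_cancel_right₀ _ hL.ne']

/-- A product of a binomial coefficient and a rounded real, both in `n^{o(1)}`, is in `n^{o(1)}`. -/
theorem inPowLittleO_mul_ceil {q : ℕ → ℕ} {Z u v : ℕ → ℝ} (hq : ∀ᶠ n in atTop, 1 ≤ q n)
    (hZ : ∀ᶠ n in atTop, 1 ≤ Z n)
    (hqu : ∀ᶠ n in atTop, Real.log (q n) / Real.log n ≤ u n) (hu : Tendsto u atTop (𝓝 0))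
    (hZv : ∀ᶠ n in atTop, Real.log (Z n) / Real.log n ≤ v n) (hv : Tendsto v atTop (𝓝 0)) :
    InPowLittleO (fun n => ((q n * ⌈Z n⌉₊ : ℕ) : ℝ)) fun _ => 1 := by
  have hpos : ∀ᶠ n in atTop, 1 ≤ q n * ⌈Z n⌉₊ := by
    filter_upwards [hq, hZ] with n h1 h2
    exact Nat.mul_pos h1 (Nat.ceil_pos.2 (by linarith))
  refine inPowLittleO_of_tendsto (hpos.mono fun n hn => by exact_mod_cast hn) ?_
  have hlim : Tendsto (fun n => u n + (Real.log 2 / Real.log (n : ℝ) + v n)) atTop (𝓝 0) := by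
    have := hu.add ((tendsto_log_natCast.const_div_atTop (Real.log 2)).add hv)
    simpa using this
  refine squeeze_zero' ?_ ?_ hlim
  · filter_upwards [hpos, eventually_ge_atTop 2] with n h1 h2
    have h3 : (1 : ℝ) ≤ ((q n * ⌈Z n⌉₊ : ℕ) : ℝ) := by exact_mod_cast h1
    have h4 : (1 : ℝ) ≤ n := by exact_mod_cast (by omega : 1 ≤ n)
    exact div_nonneg (Real.log_nonneg h3) (Real.log_nonneg h4)
  · filter_upwards [hq, hZ, hqu, hZv, eventually_ge_atTop 2] with n h1 h2 h3 h4 h5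
    have hn : (2 : ℝ) ≤ n := by exact_mod_cast h5
    have hL : 0 < Real.log n := Real.log_pos (by linarith)
    have hq0 : (0 : ℝ) < q n := by exact_mod_cast h1
    have hc0 : (0 : ℝ) < ⌈Z n⌉₊ := by exact_mod_cast Nat.ceil_pos.2 (by linarith)
    have hc : (⌈Z n⌉₊ : ℝ) ≤ 2 * Z n := by
      have := Nat.ceil_lt_add_one (show 0 ≤ Z n by linarith)
      linarith
    have h6 := Real.log_le_log hc0 hc
    rw [Real.log_mul two_ne_zero (by linarith)] at h6
    rw [Nat.cast_mul, Real.log_mul hq0.ne' hc0.ne', add_div]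
    refine add_le_add h3 ?_
    calc Real.log ⌈Z n⌉₊ / Real.log n ≤ (Real.log 2 + Real.log (Z n)) / Real.log n := by gcongr
      _ = Real.log 2 / Real.log n + Real.log (Z n) / Real.log n := add_div _ _ _
      _ ≤ _ := by linarith

theorem tendsto_log_log_div_log :
    Tendsto (fun n : ℕ => Real.log (Real.log n) / Real.log n) atTop (𝓝 0) :=
  (Real.isLittleO_log_id_atTop.tendsto_div_nhds_zero).comp tendsto_log_natCast

end Growth

/-! ### The two growth regimes -/

section Regimes

variable {d : ℕ → ℕ} {δ γ a : ℕ → ℝ}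

/-- The ratio `ρ = 1/γ` makes `exp (ρ γ log n)` equal to `n`, so a degree of order `a log n / log
(1/γ) = o(log n)` suffices. The hypothesis relating `a` and `δ` then makes the number of monomials
`n^{o(1)}`. -/
theorem exists_rank_of_gamma_small
    (hδ : ∀ n, δ n = (d n : ℝ) / Real.log n) (hγ : ∀ n, 2 ≤ n → 0 < γ n)
    (ha : ∀ n, 2 ≤ n → 1 / 2 ≤ a n) (hγ0 : γ =o[atTop] (fun _ => (1 : ℝ)))
    (haγ : a =o[atTop] (fun n => Real.log (1 / γ n) / max (Real.log (δ n)) 1))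
    (ha1 : InPowLittleO a (fun _ => 1)) :
    ∃ r : ℕ → ℕ, InPowLittleO (fun n => (r n : ℝ)) (fun _ => 1) ∧
      ∀ᶠ n in atTop, IsGoodRank n (d n) (γ n) (a n) (r n) := by
  have hγt : Tendsto γ atTop (𝓝 0) := (isLittleO_one_iff ℝ).1 hγ0
  have hγ1 : ∀ᶠ n in atTop, γ n < 1 := hγt.eventually_lt_const zero_lt_one
  have hρ1 := one_le_rhoZero
  have harg : ∀ᶠ n in atTop, Real.exp 1 ≤ lambertArg (γ n) := by
    have hc : (0 : ℝ) < 1 / (Real.exp 1 * (2 * rhoZero)) := by positivity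
    filter_upwards [hγt.eventually_lt_const hc, eventually_ge_atTop 2] with n h1 h2
    have hg := hγ n h2
    rw [lambertArg, le_div_iff₀ (by positivity)]
    have h3 : Real.exp 1 * (2 * rhoZero) ≤ 1 / γ n := by
      rw [le_div_iff₀ hg]
      rw [lt_div_iff₀ (by positivity)] at h1
      linarith
    linarith
  have hlogL := tendsto_log_natCast.eventually_ge_atTop 1
  -- Since `γ · tempScale γ ≤ 3/2`, `γ ≤ 1` and `1 ≤ 2a`, the coefficient in `Z` is at most `2a +
  -- 13/2 ≤ 15a`. The factor `ρ γ = 1` costs at most another `2a`, whence `17`.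
  set η : ℕ → ℝ := fun n => 17 * a n / Real.log (1 / γ n) with hη
  set s : ℕ → ℕ := fun n => ⌊η n * Real.log n⌋₊ with hs
  set Z : ℕ → ℝ := fun n => 15 * a n * Real.log n with hZ
  have hηM : Tendsto (fun n => η n * max (Real.log (δ n)) 1) atTop (𝓝 0) := by
    have h1 := haγ.tendsto_div_nhds_zero.const_mul 17
    rw [mul_zero] at h1
    refine h1.congr fun n => ?_
    rw [hη, div_div_eq_mul_div]
    ring
  have hη0 : ∀ᶠ n in atTop, 0 ≤ η n := by
    filter_upwards [hγ1, eventually_ge_atTop 2] with n h1 h2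
    have h3 : 0 ≤ Real.log (1 / γ n) :=
      Real.log_nonneg (by rw [le_div_iff₀ (hγ n h2)]; linarith)
    have := ha n h2
    exact div_nonneg (by linarith) h3
  have hηt : Tendsto η atTop (𝓝 0) := by
    refine squeeze_zero' hη0 ?_ hηM
    filter_upwards [hη0] with n h1
    have := le_max_right (Real.log (δ n)) 1
    nlinarith
  refine ⟨fun n => (d n + s n).choose (s n) * ⌈Z n⌉₊, ?_, ?_⟩
  · refine inPowLittleO_mul_ceil
      (u := fun n => 2 * (η n * max (Real.log (δ n)) 1) + 2 * √(η n))
      (v := fun n => Real.log 15 / Real.log n + Real.log (a n) / Real.log n / 1 +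
        Real.log (Real.log n) / Real.log n)
      (Eventually.of_forall fun n => Nat.choose_pos (Nat.le_add_left _ _)) ?_ ?_ ?_ ?_ ?_
    · filter_upwards [hlogL, eventually_ge_atTop 2] with n h1 h2
      have := ha n h2
      simp only [hZ]
      nlinarith
    · filter_upwards [hlogL, hη0] with n h1 h2
      rw [div_le_iff₀ (by linarith), mul_comm _ (Real.log n)]
      exact log_choose_le_of_degree_le (by linarith) h2 (hδ n)
        (Nat.floor_le (mul_nonneg h2 (by linarith)))
    · have := (hηM.const_mul 2).add ((hηt.sqrt).const_mul 2)
      simpa using this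
    · filter_upwards [hlogL, eventually_ge_atTop 2] with n h1 h2
      have := ha n h2
      simp only [hZ]
      rw [Real.log_mul (by linarith) (by linarith), Real.log_mul (by norm_num) (by linarith),
        div_one, add_div, add_div]
    · have := ((tendsto_log_natCast.const_div_atTop (Real.log 15)).add
        (ha1.tendsto)).add tendsto_log_log_div_log
      simpa using this
  · filter_upwards [hγ1, harg, hlogL, eventually_ge_atTop 2, hη0] with n h1 h2 h3 h4 h5
    have hg := hγ n h4
    have ha' := ha n h4
    have h6 := mul_tempScale_le_of_small hg h1.le h2
    have hl : 0 < Real.log (1 / γ n) := Real.log_pos (by rw [lt_div_iff₀ hg]; linarith)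
    refine isGoodRank (ρ := 1 / γ n) (Z := Z n) (s := s n) h4 hg ?_ ?_ ?_ ?_
    · rw [le_div_iff₀ hg]; linarith
    · simp only [hZ]
      refine mul_le_mul_of_nonneg_right ?_ (by linarith)
      linarith
    · have h7 : 1 / γ n * γ n = 1 := by field_simp
      have h8 : η n * Real.log n ≤ s n + 1 := (Nat.lt_floor_add_one _).le
      have h9 : η n * Real.log n * Real.log (1 / γ n) = 17 * a n * Real.log n := by
        simp only [hη]; field_simp
      have h10 := mul_le_mul_of_nonneg_right h8 hl.le
      rw [h9] at h10
      rw [h7]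
      simp only [hZ]
      nlinarith
    · rw [Nat.cast_mul]
      exact mul_le_mul_of_nonneg_left (Nat.le_ceil _) (Nat.cast_nonneg _)

/-- Now `tempScale γ` is bounded, and `ρ = e` gives a degree of order `(a + γ) log n`. The small
dimension controls the number of monomials: its logarithm is governed by `d log (a + γ)`, and the
hypotheses `n^{o(1/d)}` make this `o(log n)`. -/
theorem exists_rank_of_dim_small (hd : ∀ n, 2 ≤ n → 1 ≤ d n)
    (hδ : ∀ n, δ n = (d n : ℝ) / Real.log n) (hγ : ∀ n, 2 ≤ n → 0 < γ n)
    (ha : ∀ n, 2 ≤ n → 1 / 2 ≤ a n) (hδ0 : δ =o[atTop] (fun _ => (1 : ℝ)))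
    (hγ1 : (fun _ => (1 : ℝ)) =O[atTop] γ) (hγd : InPowLittleO γ (fun n => 1 / (d n : ℝ)))
    (had : InPowLittleO a (fun n => 1 / (d n : ℝ))) :
    ∃ r : ℕ → ℕ, InPowLittleO (fun n => (r n : ℝ)) (fun _ => 1) ∧
      ∀ᶠ n in atTop, IsGoodRank n (d n) (γ n) (a n) (r n) := by
  have hδt : Tendsto δ atTop (𝓝 0) := (isLittleO_one_iff ℝ).1 hδ0
  obtain ⟨c, hc, hcγ⟩ : ∃ c : ℝ, 0 < c ∧ ∀ᶠ n in atTop, c ≤ γ n := by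
    obtain ⟨C, hC, h⟩ := hγ1.exists_pos
    refine ⟨1 / C, by positivity, ?_⟩
    filter_upwards [h.bound, eventually_ge_atTop 2] with n h1 h2
    rw [norm_one, Real.norm_eq_abs, abs_of_pos (hγ n h2)] at h1
    rw [div_le_iff₀ hC]
    linarith
  have hρ1 := one_le_rhoZero
  set T := rhoZero * Real.exp (1 / c + 2) with hT
  have hT0 : 0 < T := by positivity
  have hlogL := tendsto_log_natCast.eventually_ge_atTop 1
  set C := T + 10 with hC
  have hC10 : 10 ≤ C := by linarith
  set y : ℕ → ℝ := fun n => (C + 3) * (a n + γ n) with hy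
  set s : ℕ → ℕ := fun n => ⌊y n * Real.log n⌋₊ with hs
  set Z : ℕ → ℝ := fun n => C * (a n + γ n) * Real.log n with hZ
  set B := (C + 4) * (3 / c + 2) with hB
  have hB0 : 0 < B := by positivity
  -- Both `a` and `γ` are bounded below, so their sum is dominated by their product, whose logarithm
  -- splits into the two terms controlled by hypothesis.
  have hag : ∀ᶠ n in atTop, 1 + y n ≤ B * (a n * γ n) := by
    filter_upwards [hcγ, eventually_ge_atTop 2] with n h1 h2
    have ha' := ha n h2
    have hg := hγ n h2
    have e1 : a n ≤ a n * γ n / c := by rw [le_div_iff₀ hc]; nlinarith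
    have e2 : γ n ≤ 2 * (a n * γ n) := by nlinarith
    have e4 : a n + γ n ≤ (1 / c + 2) * (a n * γ n) := by
      calc _ ≤ a n * γ n / c + 2 * (a n * γ n) := add_le_add e1 e2
        _ = _ := by ring
    have e5 : (1 : ℝ) ≤ 2 / c * (a n * γ n) := by
      calc (1 : ℝ) ≤ 2 * a n := by linarith
        _ ≤ 2 * (a n * γ n / c) := by linarith
        _ = _ := by ring
    have e6 : 0 < a n * γ n := by positivity
    have e7 : 0 < 1 / c := by positivity
    simp only [hy, hB]
    calc 1 + (C + 3) * (a n + γ n) ≤ 2 / c * (a n * γ n) +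
          (C + 3) * ((1 / c + 2) * (a n * γ n)) := by gcongr
      _ ≤ (C + 4) * (3 / c + 2) * (a n * γ n) := by
        have : (C + 4) * (3 / c + 2) * (a n * γ n) - (2 / c * (a n * γ n) +
          (C + 3) * ((1 / c + 2) * (a n * γ n))) =
            (a n * γ n) * ((2 * C + 7) * (1 / c) + 2) := by ring
        have h9 : 0 ≤ (a n * γ n) * ((2 * C + 7) * (1 / c) + 2) := by positivity
        linarith
  have hy0 : ∀ᶠ n in atTop, 0 ≤ y n := by
    filter_upwards [eventually_ge_atTop 2] with n h2
    have ha' := ha n h2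
    have hg := hγ n h2
    simp only [hy]
    positivity
  have hlog : ∀ᶠ n in atTop, Real.log (1 + y n) ≤
      Real.log B + (Real.log (a n) + Real.log (γ n)) := by
    filter_upwards [hag, hy0, eventually_ge_atTop 2] with n h1 h3 h2
    have ha' := ha n h2
    have hg := hγ n h2
    have := Real.log_le_log (by linarith) h1
    rwa [Real.log_mul hB0.ne' (by positivity), Real.log_mul (by linarith) hg.ne'] at this
  have hlogadiv : ∀ {f : ℕ → ℝ}, InPowLittleO f (fun n => 1 / (d n : ℝ)) →
      Tendsto (fun n => δ n * Real.log (f n)) atTop (𝓝 0) := by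
    intro f hf
    refine (hf.tendsto).congr fun n => ?_
    rw [hδ]
    simp only [one_div, div_inv_eq_mul]
    ring
  have hδlog : Tendsto (fun n => δ n * (Real.log B + (Real.log (a n) + Real.log (γ n)))) atTop
      (𝓝 0) := by
    have h1 := (hδt.mul_const (Real.log B)).add ((hlogadiv had).add (hlogadiv hγd))
    simp only [zero_mul, add_zero] at h1
    exact h1.congr fun n => by ring
  have hloga : ∀ {f : ℕ → ℝ}, InPowLittleO f (fun n => 1 / (d n : ℝ)) →
      Tendsto (fun n => Real.log (f n) / Real.log n) atTop (𝓝 0) := by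
    intro f hf
    have h1 := (hf.tendsto).abs
    rw [abs_zero] at h1
    refine squeeze_zero_norm' ?_ h1
    filter_upwards [eventually_ge_atTop 2] with n h2
    rw [Real.norm_eq_abs, div_div_eq_mul_div, div_one, abs_mul]
    have : (1 : ℝ) ≤ |(d n : ℝ)| := by
      rw [Nat.abs_cast]; exact_mod_cast hd n h2
    exact le_mul_of_one_le_right (abs_nonneg _) this
  refine ⟨fun n => (d n + s n).choose (s n) * ⌈Z n⌉₊, ?_, ?_⟩
  · refine inPowLittleO_mul_ceil
      (u := fun n => δ n + δ n * (Real.log B + (Real.log (a n) + Real.log (γ n))) + 2 * √(δ n))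
      (v := fun n => Real.log B / Real.log n + (Real.log (a n) / Real.log n +
        Real.log (γ n) / Real.log n) + Real.log (Real.log n) / Real.log n)
      (Eventually.of_forall fun n => Nat.choose_pos (Nat.le_add_left _ _)) ?_ ?_ ?_ ?_ ?_
    · filter_upwards [hlogL, eventually_ge_atTop 2] with n h1 h2
      have ha' := ha n h2
      have hg := hγ n h2
      simp only [hZ]
      have : 1 ≤ C * (a n + γ n) := by nlinarith
      nlinarith
    · filter_upwards [hlogL, hy0, hlog, eventually_ge_atTop 2] with n h1 h2 h3 h4
      rw [div_le_iff₀ (by linarith), mul_comm _ (Real.log n)]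
      refine (log_choose_le_of_dim (by linarith) (hd n h4) h2 (hδ n)
        (Nat.floor_le (mul_nonneg h2 (by linarith)))).trans ?_
      have : 0 ≤ δ n := by rw [hδ]; exact div_nonneg (Nat.cast_nonneg _) (by linarith)
      gcongr
    · have := (hδt.add hδlog).add ((hδt.sqrt).const_mul 2)
      simpa using this
    · filter_upwards [hlogL, hlog, eventually_ge_atTop 2] with n h1 h3 h2
      have ha' := ha n h2
      have hg := hγ n h2
      have h4 : C * (a n + γ n) ≤ 1 + y n := by simp only [hy]; nlinarith
      have h5 : 0 < C * (a n + γ n) := by positivity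
      have h6 := (Real.log_le_log h5 h4).trans h3
      simp only [hZ]
      rw [Real.log_mul h5.ne' (by linarith), ← add_div, ← add_div, ← add_div]
      gcongr
    · have := ((tendsto_log_natCast.const_div_atTop (Real.log B)).add
        ((hloga had).add (hloga hγd))).add tendsto_log_log_div_log
      simpa using this
  · filter_upwards [hcγ, hlogL, eventually_ge_atTop 2] with n h1 h3 h4
    have hg := hγ n h4
    have ha' := ha n h4
    have h6 : γ n * tempScale (γ n) ≤ γ n * T :=
      mul_le_mul_of_nonneg_left (tempScale_le hc h1) hg.le
    refine isGoodRank (ρ := Real.exp 1) (Z := Z n) (s := s n) h4 hg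
      (Real.one_le_exp zero_le_one) ?_ ?_ ?_
    · simp only [hZ, hC]
      refine mul_le_mul_of_nonneg_right ?_ (by linarith)
      nlinarith
    · have h8 : y n * Real.log n ≤ s n + 1 := (Nat.lt_floor_add_one _).le
      have h9 := Real.exp_one_lt_three
      have h10 : Real.exp 1 * γ n * Real.log n ≤ 3 * γ n * Real.log n := by gcongr
      have h11 : 0 ≤ a n * Real.log n := mul_nonneg (by linarith) (by linarith)
      rw [Real.log_exp, mul_one]
      simp only [hZ]
      simp only [hy] at h8
      nlinarith
    · rw [Nat.cast_mul]
      exact mul_le_mul_of_nonneg_left (Nat.le_ceil _) (Nat.cast_nonneg _)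

end Regimes

end WildCat

theorem mainTheorem3 (d : ℕ → ℕ) (δ γ a : ℕ → ℝ)
    (hd : ∀ n, 2 ≤ n → 1 ≤ d n)
    (hδ : ∀ n, δ n = (d n : ℝ) / Real.log n)
    (hγ : ∀ n, 2 ≤ n → 0 < γ n)
    (ha : ∀ n, 2 ≤ n → 1 / 2 ≤ a n)
    (hgrowth :
      (γ =o[atTop] (fun _ => (1 : ℝ)) ∧
        a =o[atTop] (fun n => Real.log (1 / γ n) / max (Real.log (δ n)) 1) ∧
        WildCat.InPowLittleO a (fun _ => 1)) ∨
      (δ =o[atTop] (fun _ => (1 : ℝ)) ∧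
        (fun _ => (1 : ℝ)) =O[atTop] γ ∧
        WildCat.InPowLittleO γ (fun n => 1 / (d n : ℝ)) ∧
        WildCat.InPowLittleO a (fun n => 1 / (d n : ℝ)))) :
    ∃ r : ℕ → ℕ, WildCat.InPowLittleO (fun n => (r n : ℝ)) (fun _ => 1) ∧
      ∀ n : ℕ, 2 ≤ n →
        ∀ (m : ℕ) (β : ℝ) (Q : Matrix (Fin m) (Fin (d n)) ℝ) (K V : Matrix (Fin n) (Fin (d n)) ℝ),
          0 < β →
          β * WildCat.rowNorm Q * WildCat.rowNorm (WildCat.recenter K) / Real.log n = γ n →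
          WildCat.expectation (WildCat.wildcat Q K V β (r n))
              (fun O' => ENNReal.ofReal
                (WildCat.maxNorm (WildCat.softmaxAttention β Q K V - O'))) ≤
            ENNReal.ofReal (3 * WildCat.maxNorm V * (n : ℝ) ^ (-a n)) := by
  obtain ⟨r, ⟨e, he, hre⟩, hgood⟩ : ∃ r : ℕ → ℕ,
      WildCat.InPowLittleO (fun n => (r n : ℝ)) (fun _ => 1) ∧
      ∀ᶠ n in atTop, WildCat.IsGoodRank n (d n) (γ n) (a n) (r n) := by
    rcases hgrowth with ⟨h1, h2, h3⟩ | ⟨h1, h2, h3, h4⟩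
    · exact WildCat.exists_rank_of_gamma_small hδ hγ ha h1 h2 h3
    · exact WildCat.exists_rank_of_dim_small hd hδ hγ ha h1 h2 h3 h4
  -- The size `r n` is kept wherever it is good, hence for all large `n`, and is replaced elsewhere.
  -- The growth exponent `e` is thereby unchanged.
  have hex : ∀ n, ∃ k, (2 ≤ n → WildCat.IsGoodRank n (d n) (γ n) (a n) k) ∧
      (WildCat.IsGoodRank n (d n) (γ n) (a n) (r n) → k = r n) := by
    intro n
    by_cases h : WildCat.IsGoodRank n (d n) (γ n) (a n) (r n)
    · exact ⟨r n, fun _ => h, fun _ => rfl⟩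
    · by_cases hn : 2 ≤ n
      · obtain ⟨k, hk⟩ := WildCat.exists_isGoodRank (d := d n) (a := a n) hn (hγ n hn)
        exact ⟨k, fun _ => hk, fun h' => absurd h' h⟩
      · exact ⟨0, fun h' => absurd h' hn, fun h' => absurd h' h⟩
  choose k hk hkr using hex
  refine ⟨k, ⟨e, he, ?_⟩, fun n hn => hk n hn⟩
  filter_upwards [hre, hgood] with n h1 h2
  rw [hkr n h2, h1]
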